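/- \textbf{Setting.} Let $\Omega\subset\mathbb R^2$ be a bounded domain whose boundary $\Gamma$ consists of finitely many pairwise disjoint simple closed polygonal curves. A decomposition $\mathcal T_h$ of $\Omega$ is a finite family of non-overlapping open polygons $K$ (each bounded by a simple closed polygonal curve; consecutive edges may be collinear, so that hanging nodes are vertices) whose closures cover $\Omega$; the relative interior of each edge lies in $\Omega$ or in $\Gamma$, and two edges coincide or have disjoint relative interiors. We write $h_K$ for the diameter of $K$, $\mathcal E(K)$ for the set of edges of $K$, $\mathcal E_h(\Omega)$ for the set of edges lying in $\Omega$, $h_e$ and $s_e$ for the length and a unit tangent of an edge $e$, and $\omega_e$ for the union of the elements having $e$ as an edge. The decomposition is regular with constant $C_{\mathcal T}>0$ if for every $K\in\mathcal T_h$ all edges of $K$ are longer than $C_{\mathcal T}h_K$ and $K$ is star-shaped with respect to a ball of radius $C_{\mathcal T}h_K$. For an integer $\ell$, $\mathrm P_\ell$ denotes the polynomials of degree at most $\ell$ ($\mathrm P_{-1}=\{0\}$). Put $\mathrm{rot}\,\tau=\partial_1\tau_2-\partial_2\tau_1$. For a field $q$ that is polynomial on each element, $\mathrm{rot}\,q$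 is taken element by element and $[\![q\cdot s_e]\!]=(q|_K-q|_{K'})|_e\cdot s_e$ for $e\in\mathcal E_h(\Omega)$ shared by $K$ and $K'$. $\|\cdot\|_{0,S}$ is the $\mathrm L^2(S)$-norm. \textbf{(a)} For every $C_{\mathcal T}>0$ and every integer $k\ge0$ there is $C>0$, depending only on $C_{\mathcal T}$ and $k$, such that for every such $\Omega$, every decomposition $\mathcal T_h$ of $\Omega$ regular with constant $C_{\mathcal T}$, every $\zeta_h$ with $\zeta_h|_K\in[\mathrm P_k(K)]^2$ for all $K\in\mathcal T_h$, and every $\zeta\in[\mathrm L^2(\Omega)]^2$ with $\mathrm{rot}\,\zeta=0$ in $\Omega$ in the sense of distributions, $$h_K\|\mathrm{rot}\,\zeta_h\|_{0,K}\le C\|\zeta-\zeta_h\|_{0,K}\quad\forall K\in\mathcal T_h,\qquad h_e^{1/2}\|[\![\zeta_h\cdot s_e]\!]\|_{0,e}\le C\|\zeta-\zeta_h\|_{0,\omega_e}\quad\forall e\in\mathcal E_h(\Omega).$$ \textbf{(b)} Let $\Gamma$ be split into disjoint relatively open parts $\Gamma_D,\Gamma_N$ of positive length with $\Gamma=\overline\Gamma_D\cup\overline\Gamma_N$,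 let $\kappa\in[\mathrm L^\infty(\Omega)]^{2\times2}$ be uniformly positive definite, $f\in\mathrm L^2(\Omega)$, $g\in\mathrm H^{1/2}(\Gamma_D)$, and let $H=\{\tau\in\mathrm H(\mathrm{div};\Omega):\tau\cdot\nu=0\text{ on }\Gamma_N\}$. Let $(\sigma,u)\in H\times\mathrm L^2(\Omega)$ solve $$\int_\Omega\kappa^{-1}\sigma\cdot\tau+\int_\Omega u\,\mathrm{div}\,\tau=\langle\tau\cdot\nu,g\rangle_{\Gamma_D}\ \ \forall\tau\in H,\qquad \int_\Omega v\,\mathrm{div}\,\sigma=-\int_\Omega fv\ \ \forall v\in\mathrm L^2(\Omega),$$ that is, the mixed form of $-\mathrm{div}(\kappa\nabla u)=f$, $u=g$ on $\Gamma_D$, $\kappa\nabla u\cdot\nu=0$ on $\Gamma_N$, with $\sigma=\kappa\nabla u$. Let $\mathcal T_h$ be regular with constant $C_{\mathcal T}$, with every boundary edge contained in $\Gamma_D$ or in $\Gamma_N$, and let $k\ge0$. Let $H_h^K$ be the set of $\tau\in\mathrm H(\mathrm{div};K)\cap\mathrm H(\mathrm{rot};K)$ with $\tau\cdot\nu|_e\in\mathrm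 P_k(e)$ for all $e\in\mathcal E(K)$, $\mathrm{div}\,\tau\in\mathrm P_k(K)$ and $\mathrm{rot}\,\tau\in\mathrm P_{k-1}(K)$; let $H_h=\{\tau\in H:\tau|_K\in H_h^K\ \forall K\}$ and $Q_h=\{v:v|_K\in\mathrm P_k(K)\ \forall K\}$. Let $\mathbf\Pi_k^0$ be the elementwise $\mathrm L^2$-projection onto $[\mathrm P_k(K)]^2$, $a^K(\zeta,\tau)=\int_K\kappa^{-1}\zeta\cdot\tau$ and $$a_h^K(\zeta,\tau)=a^K(\mathbf\Pi_k^0\zeta,\mathbf\Pi_k^0\tau)+\mathcal S^K(\zeta-\mathbf\Pi_k^0\zeta,\tau-\mathbf\Pi_k^0\tau),$$ where $\mathcal S^K$ is any symmetric positive definite bilinear form on $H_h^K$ with $\widehat c_0a^K(\zeta,\zeta)\le\mathcal S^K(\zeta,\zeta)\le\widehat c_1a^K(\zeta,\zeta)$ whenever $\mathbf\Pi_k^0\zeta=0$ (for some $\widehat c_0,\widehat c_1>0$). Let $(\sigma_h,u_h)\in H_h\times Q_h$ solve $$\sum_{K\in\mathcal T_h}a_h^K(\sigma_h,\tau)+\int_\Omega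 u_h\,\mathrm{div}\,\tau=\langle\tau\cdot\nu,g\rangle_{\Gamma_D}\ \ \forall\tau\in H_h,\qquad\int_\Omega v\,\mathrm{div}\,\sigma_h=-\int_\Omega fv\ \ \forall v\in Q_h,$$ and let the postprocessed flux $\sigma_h^\star$ be defined by $\sigma_h^\star|_K\in[\mathrm P_{k+1}(K)]^2$ and $$\int_K\sigma_h^\star\cdot\tau+\int_K\mathrm{div}\,\sigma_h^\star\,\mathrm{div}\,\tau=\int_K\mathbf\Pi_k^0\sigma_h\cdot\tau+\int_K\mathrm{div}\,\sigma_h\,\mathrm{div}\,\tau\quad\forall\tau\in[\mathrm P_{k+1}(K)]^2,\ K\in\mathcal T_h.$$ Let $\kappa_h$ be a tensor with $\kappa_h|_K\in[\mathrm P_m(K)]^{2\times2}$ for all $K$ (an approximation of $\kappa^{-1}$), and put, for $S\subseteq\Omega$, $$\mathcal R_S=\|\sigma-\sigma_h^\star\|_{0,S}^2+\|(\kappa^{-1}-\kappa_h)\sigma_h^\star\|_{0,S}^2,$$ $$\theta_{1,K}^2=h_K^2\|\mathrm{rot}(\kappa_h\sigma_h^\star)\|_{0,K}^2,\qquad\theta_{2,K}^2=\sum_{e\in\mathcal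 E(K)\cap\mathcal E_h(\Omega)}h_e\|[\![\kappa_h\sigma_h^\star\cdot s_e]\!]\|_{0,e}^2.$$ Then there is $C>0$, depending only on $\Omega,\Gamma_D,\Gamma_N,\kappa,C_{\mathcal T},k$ and $m$ (in particular not on $\mathcal T_h$), such that $$\theta_{1,K}^2\le C\,\mathcal R_K\ \ \forall K\in\mathcal T_h,\qquad h_e\|[\![\kappa_h\sigma_h^\star\cdot s_e]\!]\|_{0,e}^2\le C\,\mathcal R_{\omega_e}\ \ \forall e\in\mathcal E_h(\Omega),$$ and hence $\theta_{2,K}^2\le C\sum_{e\in\mathcal E(K)\cap\mathcal E_h(\Omega)}\mathcal R_{\omega_e}$ for all $K\in\mathcal T_h$. -/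

import Mathlib

open MeasureTheory Set
open scoped ContDiff RealInnerProductSpace

noncomputable section

namespace MixedVEM

/-- The Euclidean plane. -/
abbrev Plane := EuclideanSpace ℝ (Fin 2)

/-! ### Polygons, polygonal domains and decompositions -/

/-- A simple closed polygonal curve with `n + 3` vertices, listed cyclically; two consecutive edges
may be collinear (so hanging nodes are allowed as vertices). -/
structure ClosedPolygon where
  n : ℕ
  vertex : Fin (n + 3) → Plane
  injective : Function.Injective vertex
  simple : ∀ i j, i ≠ j →
    segment ℝ (vertex i) (vertex (i + 1)) ∩ segment ℝ (vertex j) (vertex (j + 1)) ⊆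
      {vertex i, vertex (i + 1)} ∩ {vertex j, vertex (j + 1)}

/-- The curve itself: the union of the closed edges. -/
def ClosedPolygon.curve (P : ClosedPolygon) : Set Plane :=
  ⋃ i, segment ℝ (P.vertex i) (P.vertex (i + 1))

/-- An open polygonal element: the bounded open set enclosed by a simple closed polygonal curve. -/
structure Element extends ClosedPolygon where
  carrier : Set Plane
  isOpen : IsOpen carrier
  isBounded : Bornology.IsBounded carrier
  frontier_eq : frontier carrier = toClosedPolygon.curve

/-- The diameter `h_K`. -/
def Element.diam (K : Element) : ℝ := Metric.diam K.carrier

/-- The segment with endpoints `a`, `b` (in either order) is an edge of `K`. -/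
def Element.IsEdge (K : Element) (a b : Plane) : Prop :=
  ∃ i, (a = K.vertex i ∧ b = K.vertex (i + 1)) ∨ (b = K.vertex i ∧ a = K.vertex (i + 1))

/-- Bounded domains whose boundary is polygonal, that is, made of finitely many pairwise disjoint
simple closed polygonal curves. -/
structure IsPolygonalDomain (Ω : Set Plane) : Prop where
  isOpen : IsOpen Ω
  isBounded : Bornology.IsBounded Ω
  isConnected : IsConnected Ω
  polygonal : ∃ (m : ℕ) (P : Fin m → ClosedPolygon),
    Pairwise (fun i j => Disjoint (P i).curve (P j).curve) ∧ frontier Ω = ⋃ i, (P i).curve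

/-- A finite decomposition of `Ω` into non-overlapping open polygonal elements. Each edge lies
in `Ω` or in the boundary, and two edges coincide or have no common relative interior point
(hanging nodes count as vertices of all elements they touch). -/
structure Mesh (Ω : Set Plane) where
  m : ℕ
  elem : Fin m → Element
  subset : ∀ i, (elem i).carrier ⊆ Ω
  disjoint : Pairwise fun i j => Disjoint (elem i).carrier (elem j).carrier
  cover : Ω ⊆ ⋃ i, closure (elem i).carrier
  edge_location : ∀ i a b, (elem i).IsEdge a b →
    openSegment ℝ a b ⊆ Ω ∨ openSegment ℝ a b ⊆ frontier Ω
  edge_conform : ∀ i j a b c d, (elem i).IsEdge a b → (elem j).IsEdge c d →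
    openSegment ℝ a b = openSegment ℝ c d ∨ Disjoint (openSegment ℝ a b) (openSegment ℝ c d)

variable {Ω : Set Plane}

/-- The mesh regularity assumption with constant `c`: every edge of `K` is longer than `c h_K`, and
`K` is star-shaped with respect to a ball of radius `c h_K`. -/
def Mesh.IsRegular (T : Mesh Ω) (c : ℝ) : Prop :=
  ∀ i, (∀ a b, (T.elem i).IsEdge a b → c * (T.elem i).diam < dist a b) ∧
    ∃ xB : Plane, Metric.ball xB (c * (T.elem i).diam) ⊆ (T.elem i).carrier ∧
      ∀ y ∈ Metric.ball xB (c * (T.elem i).diam), StarConvex ℝ y (T.elem i).carrier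

/-- The segment `ab` is an edge lying in `Ω`, common to the two different elements `i` and `j`. -/
def Mesh.IsInteriorEdge (T : Mesh Ω) (i j : Fin T.m) (a b : Plane) : Prop :=
  i ≠ j ∧ (T.elem i).IsEdge a b ∧ (T.elem j).IsEdge a b ∧ openSegment ℝ a b ⊆ Ω

/-- `ω_e`: the union of the elements that have `e = ab` as an edge. -/
def Mesh.patch (T : Mesh Ω) (a b : Plane) : Set Plane :=
  ⋃ i, ⋃ (_ : (T.elem i).IsEdge a b), (T.elem i).carrier

/-- The function on `Ω` (defined almost everywhere) that equals `F i` on the element `i`. -/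
def Mesh.glue (T : Mesh Ω) {V : Type*} [AddCommMonoid V] (F : Fin T.m → Plane → V) : Plane → V :=
  fun x => ∑ i, (T.elem i).carrier.indicator (F i) x

/-! ### Polynomials -/

/-- `p ∈ P_ℓ`; here `P_ℓ = {0}` for `ℓ < 0`. -/
def IsP (l : ℤ) (p : MvPolynomial (Fin 2) ℝ) : Prop := p = 0 ∨ (p.totalDegree : ℤ) ≤ l

/-- Polynomial vector fields. -/
abbrev PolyField := Fin 2 → MvPolynomial (Fin 2) ℝ

/-- `q ∈ [P_ℓ]²`. -/
def IsPField (l : ℤ) (q : PolyField) : Prop := ∀ i, IsP l (q i)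

def polyFun (p : MvPolynomial (Fin 2) ℝ) (x : Plane) : ℝ := MvPolynomial.eval (fun i => x i) p

def polyField (q : PolyField) (x : Plane) : Plane := WithLp.toLp 2 fun i => polyFun (q i) x

def polyMatrix (A : Matrix (Fin 2) (Fin 2) (MvPolynomial (Fin 2) ℝ)) (x : Plane) :
    Matrix (Fin 2) (Fin 2) ℝ := Matrix.of fun i j => polyFun (A i j) x

/-- `div q = ∂₁q₁ + ∂₂q₂`. -/
def polyDiv (q : PolyField) : MvPolynomial (Fin 2) ℝ :=
  MvPolynomial.pderiv 0 (q 0) + MvPolynomial.pderiv 1 (q 1)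

/-- `rot q = ∂₁q₂ - ∂₂q₁`. -/
def polyRot (q : PolyField) : MvPolynomial (Fin 2) ℝ :=
  MvPolynomial.pderiv 0 (q 1) - MvPolynomial.pderiv 1 (q 0)

/-! ### Norms -/

/-- `‖f‖_{0,S}`, for square integrable `f`. -/
def l2norm {V : Type*} [NormedAddCommGroup V] (S : Set Plane) (f : Plane → V) : ℝ :=
  Real.sqrt (∫ x in S, ‖f x‖ ^ 2)

/-- The integral over the segment `ab` with respect to arc length. -/
def edgeIntegral (a b : Plane) (g : Plane → ℝ) : ℝ :=
  dist a b * ∫ t in (0 : ℝ)..1, g (AffineMap.lineMap a b t)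

/-- `‖g‖_{0,e}` for `e = ab`. -/
def edgeNorm (a b : Plane) (g : Plane → ℝ) : ℝ := Real.sqrt (edgeIntegral a b fun x => g x ^ 2)

/-- The unit tangent vector `s_e` of `e = ab`. -/
def tangent (a b : Plane) : Plane := (dist a b)⁻¹ • (b - a)

/-- The tangential jump `(q|_K - q|_{K'})|_e · s` of a piecewise polynomial field across the
common edge `e = ab` of the elements `i` and `j`. -/
def tangentialJump {m : ℕ} (q : Fin m → PolyField) (i j : Fin m) (a b x : Plane) : ℝ :=
  ⟪polyField (q i) x - polyField (q j) x, tangent a b⟫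

/-! ### Weak derivatives -/

/-- `φ ∈ C_c^∞(U)`. -/
def IsTest (U : Set Plane) (φ : Plane → ℝ) : Prop :=
  ContDiff ℝ ∞ φ ∧ HasCompactSupport φ ∧ tsupport φ ⊆ U

/-- The partial derivative `∂_i φ`. -/
def pd (i : Fin 2) (φ : Plane → ℝ) (x : Plane) : ℝ := fderiv ℝ φ x (EuclideanSpace.single i 1)

/-- `∇φ = (∂₁φ, ∂₂φ)`. -/
def grad (φ : Plane → ℝ) (x : Plane) : Plane := !₂[pd 0 φ x, pd 1 φ x]

/-- The vector `rot φ = (∂₂φ, -∂₁φ)`. -/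
def curl (φ : Plane → ℝ) (x : Plane) : Plane := !₂[pd 1 φ x, -pd 0 φ x]

/-- `f ∈ L²(U)`. -/
def IsL2 {V : Type*} [NormedAddCommGroup V] (U : Set Plane) (f : Plane → V) : Prop :=
  MemLp f 2 (volume.restrict U)

/-- `v ∈ H¹(U)` with weak gradient `w`. -/
structure HasWeakGrad (U : Set Plane) (v : Plane → ℝ) (w : Plane → Plane) : Prop where
  isL2 : IsL2 U v
  isL2_grad : IsL2 U w
  weak : ∀ φ, IsTest U φ → ∀ i, ∫ x in U, v x * pd i φ x = -∫ x in U, w x i * φ x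

/-- `τ ∈ H(div; U)` with weak divergence `d`. -/
structure HasWeakDiv (U : Set Plane) (τ : Plane → Plane) (d : Plane → ℝ) : Prop where
  isL2 : IsL2 U τ
  isL2_div : IsL2 U d
  weak : ∀ φ, IsTest U φ → ∫ x in U, ⟪τ x, grad φ x⟫ = -∫ x in U, d x * φ x

/-- `τ ∈ H(rot; U)` with weak rotation `r`. -/
structure HasWeakRot (U : Set Plane) (τ : Plane → Plane) (r : Plane → ℝ) : Prop where
  isL2 : IsL2 U τ
  isL2_rot : IsL2 U r
  weak : ∀ φ, IsTest U φ → ∫ x in U, ⟪τ x, curl φ x⟫ = ∫ x in U, r x * φ x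

/-! ### The model problem in mixed form -/

/-- `Γ = ∂Ω` is split into the disjoint relatively open parts `Γ_D`, `Γ_N`, of positive length,
whose closures cover `Γ`. -/
structure IsBoundaryPartition (Ω ΓD ΓN : Set Plane) : Prop where
  disjoint : Disjoint ΓD ΓN
  open_D : ∃ U, IsOpen U ∧ ΓD = U ∩ frontier Ω
  open_N : ∃ U, IsOpen U ∧ ΓN = U ∩ frontier Ω
  cover : frontier Ω = closure ΓD ∪ closure ΓN
  pos_D : Measure.hausdorffMeasure 1 ΓD ≠ 0
  pos_N : Measure.hausdorffMeasure 1 ΓN ≠ 0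

/-- Every boundary edge of the mesh is contained in `Γ_D` or in `Γ_N`. -/
def Mesh.IsCompatible (T : Mesh Ω) (ΓD ΓN : Set Plane) : Prop :=
  ∀ i a b, (T.elem i).IsEdge a b →
    openSegment ℝ a b ⊆ Ω ∨ openSegment ℝ a b ⊆ ΓD ∨ openSegment ℝ a b ⊆ ΓN

/-- The matrix `A` applied to the vector `v`. -/
def app (A : Matrix (Fin 2) (Fin 2) ℝ) (v : Plane) : Plane := WithLp.toLp 2 (A.mulVec v.ofLp)

/-- `κ ∈ [L^∞(Ω)]^{2×2}` is uniformly positive definite. -/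
structure IsDiffusion (Ω : Set Plane) (κ : Plane → Matrix (Fin 2) (Fin 2) ℝ) : Prop where
  memLp : ∀ i j, MemLp (fun x => κ x i j) ⊤ (volume.restrict Ω)
  posDef : ∃ c > 0, ∀ᵐ x ∂volume.restrict Ω, ∀ ξ : Plane, c * ‖ξ‖ ^ 2 ≤ ⟪app (κ x) ξ, ξ⟫

/-- `τ ∈ H` with divergence `d`: `τ ∈ H(div; Ω)` and `τ · ν = 0` on `Γ_N`, where the normal trace
is defined by Green's formula, tested with smooth functions that vanish near `Γ_D`. -/
structure MemH (Ω ΓD : Set Plane) (τ : Plane → Plane) (d : Plane → ℝ) : Prop where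
  hasWeakDiv : HasWeakDiv Ω τ d
  normal_zero : ∀ v : Plane → ℝ, ContDiff ℝ ∞ v → Disjoint (tsupport v) (closure ΓD) →
    ∫ x in Ω, (⟪τ x, grad v x⟫ + d x * v x) = 0

/-- The duality pairing `⟨τ · ν, g⟩_{Γ_D}` for `τ ∈ H` with divergence `d`. The datum
`g ∈ H^{1/2}(Γ_D)` is given through an `H¹(Ω)` function `G` with trace `g` on `Γ_D` and weak
gradient `G'`; by Green's formula the value does not depend on this extension of `g`. -/
def boundaryPairing (Ω : Set Plane) (τ : Plane → Plane) (d : Plane → ℝ)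
    (G : Plane → ℝ) (G' : Plane → Plane) : ℝ :=
  ∫ x in Ω, (⟪τ x, G' x⟫ + d x * G x)

/-- `∫_S κ⁻¹ζ · τ`. -/
def aForm (κ : Plane → Matrix (Fin 2) (Fin 2) ℝ) (S : Set Plane) (ζ τ : Plane → Plane) : ℝ :=
  ∫ x in S, ⟪app (κ x)⁻¹ (ζ x), τ x⟫

/-- `(σ, u) ∈ H × L²(Ω)` solves the mixed variational formulation; `σ'` is the divergence of `σ`. -/
structure IsMixedSolution (Ω ΓD : Set Plane) (κ : Plane → Matrix (Fin 2) (Fin 2) ℝ)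
    (f : Plane → ℝ) (G : Plane → ℝ) (G' : Plane → Plane)
    (σ : Plane → Plane) (σ' : Plane → ℝ) (u : Plane → ℝ) : Prop where
  memH : MemH Ω ΓD σ σ'
  isL2 : IsL2 Ω u
  eq_flux : ∀ τ d, MemH Ω ΓD τ d →
    aForm κ Ω σ τ + ∫ x in Ω, u x * d x = boundaryPairing Ω τ d G G'
  eq_mass : ∀ v, IsL2 Ω v → ∫ x in Ω, v x * σ' x = -∫ x in Ω, f x * v x

/-! ### The mixed virtual element method -/

/-- `τ|_K ∈ H_h^K` with divergence `d`: `div τ ∈ P_k(K)`, `rot τ ∈ P_{k-1}(K)` and, in the sense of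
Green's formula, `τ · ν ∈ P_k(e)` on each edge `e`. -/
structure MemVEM (K : Element) (k : ℕ) (τ : Plane → Plane) (d : Plane → ℝ) : Prop where
  hasWeakDiv : HasWeakDiv K.carrier τ d
  div_poly : ∃ p, IsP k p ∧ d =ᵐ[volume.restrict K.carrier] polyFun p
  rot_poly : ∃ r, IsP ((k : ℤ) - 1) r ∧ HasWeakRot K.carrier τ (polyFun r)
  normal_poly : ∃ g : Fin (K.n + 3) → MvPolynomial (Fin 2) ℝ, (∀ i, IsP k (g i)) ∧
    ∀ v : Plane → ℝ, ContDiff ℝ ∞ v →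
      ∫ x in K.carrier, (⟪τ x, grad v x⟫ + d x * v x) =
        ∑ i, edgeIntegral (K.vertex i) (K.vertex (i + 1)) fun x => polyFun (g i) x * v x

/-- `p` is the `L²(K)`-orthogonal projection of `τ` onto `[P_k(K)]²`. -/
def IsL2Proj (K : Element) (k : ℕ) (τ : Plane → Plane) (p : PolyField) : Prop :=
  IsPField k p ∧ ∀ q, IsPField k q →
    ∫ x in K.carrier, ⟪τ x - polyField p x, polyField q x⟫ = 0

/-- The projection `Π_k^0 τ` on `K`, for square integrable `τ`. -/
def l2Proj (K : Element) (k : ℕ) (τ : Plane → Plane) : PolyField :=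
  Classical.epsilon (IsL2Proj K k τ)

/-- `S` is an admissible stabilising form on `H_h^K`: symmetric, positive definite, and equivalent
to `a^K` on the kernel of the projection. Only its values on `H_h^K` matter: every bilinear form on
this subspace extends to all functions. -/
structure IsStabilization (κ : Plane → Matrix (Fin 2) (Fin 2) ℝ) (K : Element) (k : ℕ)
    (c₀ c₁ : ℝ) (S : LinearMap.BilinForm ℝ (Plane → Plane)) : Prop where
  symm : ∀ ζ ζ' τ τ', MemVEM K k ζ ζ' → MemVEM K k τ τ' → S ζ τ = S τ ζ
  eq_zero : ∀ ζ ζ', MemVEM K k ζ ζ' → ζ =ᵐ[volume.restrict K.carrier] 0 → S ζ ζ = 0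
  pos : ∀ ζ ζ', MemVEM K k ζ ζ' → ¬ ζ =ᵐ[volume.restrict K.carrier] 0 → 0 < S ζ ζ
  bounds : ∀ ζ ζ', MemVEM K k ζ ζ' → IsL2Proj K k ζ 0 →
    c₀ * aForm κ K.carrier ζ ζ ≤ S ζ ζ ∧ S ζ ζ ≤ c₁ * aForm κ K.carrier ζ ζ

/-- The discrete local form
`a_h^K(ζ, τ) = a^K(Πζ, Πτ) + S^K(ζ - Πζ, τ - Πτ)`. -/
def ahK (κ : Plane → Matrix (Fin 2) (Fin 2) ℝ) (K : Element) (k : ℕ)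
    (S : LinearMap.BilinForm ℝ (Plane → Plane)) (ζ τ : Plane → Plane) : ℝ :=
  aForm κ K.carrier (polyField (l2Proj K k ζ)) (polyField (l2Proj K k τ)) +
    S (ζ - polyField (l2Proj K k ζ)) (τ - polyField (l2Proj K k τ))

/-- `τ ∈ H_h` with divergence `d`. -/
def Mesh.MemHh (T : Mesh Ω) (ΓD : Set Plane) (k : ℕ) (τ : Plane → Plane) (d : Plane → ℝ) : Prop :=
  MemH Ω ΓD τ d ∧ ∀ i, MemVEM (T.elem i) k τ d

/-- `(σ_h, u_h) ∈ H_h × Q_h` solves the virtual element scheme; `σ_h'` is the divergence of `σ_h`,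
and `u_h` is given by its polynomial pieces. -/
structure Mesh.IsDiscreteSolution (T : Mesh Ω) (ΓD : Set Plane) (k : ℕ)
    (κ : Plane → Matrix (Fin 2) (Fin 2) ℝ)
    (S : Fin T.m → LinearMap.BilinForm ℝ (Plane → Plane))
    (f : Plane → ℝ) (G : Plane → ℝ) (G' : Plane → Plane)
    (σh : Plane → Plane) (σh' : Plane → ℝ) (uh : Fin T.m → MvPolynomial (Fin 2) ℝ) : Prop where
  mem : T.MemHh ΓD k σh σh'
  poly : ∀ i, IsP k (uh i)
  eq_flux : ∀ τ d, T.MemHh ΓD k τ d →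
    ∑ i, ahK κ (T.elem i) k (S i) σh τ + ∫ x in Ω, T.glue (fun i => polyFun (uh i)) x * d x =
      boundaryPairing Ω τ d G G'
  eq_mass : ∀ vh : Fin T.m → MvPolynomial (Fin 2) ℝ, (∀ i, IsP k (vh i)) →
    ∫ x in Ω, T.glue (fun i => polyFun (vh i)) x * σh' x =
      -∫ x in Ω, f x * T.glue (fun i => polyFun (vh i)) x

/-- `σ_h^⋆` is the postprocessed flux: on each `K` the element of `[P_{k+1}(K)]²` with
`(σ_h^⋆, τ)_{div;K} = ∫_K Π_k^0 σ_h · τ + ∫_K div σ_h div τ` for all `τ ∈ [P_{k+1}(K)]²`. -/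
def Mesh.IsPostprocessed (T : Mesh Ω) (k : ℕ) (σh : Plane → Plane) (σh' : Plane → ℝ)
    (σs : Fin T.m → PolyField) : Prop :=
  ∀ i, IsPField (k + 1) (σs i) ∧ ∀ q, IsPField (k + 1) q →
    (∫ x in (T.elem i).carrier, ⟪polyField (σs i) x, polyField q x⟫) +
        ∫ x in (T.elem i).carrier, polyFun (polyDiv (σs i)) x * polyFun (polyDiv q) x =
      (∫ x in (T.elem i).carrier, ⟪polyField (l2Proj (T.elem i) k σh) x, polyField q x⟫) +
        ∫ x in (T.elem i).carrier, σh' x * polyFun (polyDiv q) x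

/-! ### Error indicators -/

/-- `h_K² ‖rot q‖²_{0,K}` for a piecewise polynomial field `q`. -/
def Mesh.thetaOneSq (T : Mesh Ω) (q : Fin T.m → PolyField) (i : Fin T.m) : ℝ :=
  (T.elem i).diam ^ 2 * l2norm (T.elem i).carrier (polyFun (polyRot (q i))) ^ 2

open Classical in
/-- `∑ h_e ‖[[q · s]]‖²_{0,e}` over the edges `e` of `K` that lie in `Ω`, the index `j` being that of
the other element with the edge `e`. -/
def Mesh.thetaTwoSq (T : Mesh Ω) (q : Fin T.m → PolyField) (i : Fin T.m) : ℝ :=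
  ∑ l : Fin ((T.elem i).n + 3), ∑ j : Fin T.m,
    let a := (T.elem i).vertex l
    let b := (T.elem i).vertex (l + 1)
    if T.IsInteriorEdge i j a b then dist a b * edgeNorm a b (tangentialJump q i j a b) ^ 2 else 0

/-- `‖σ - σ_h^⋆‖²_{0,S} + ‖(κ⁻¹ - κ_h) σ_h^⋆‖²_{0,S}`. -/
def Mesh.errOscSq (T : Mesh Ω) (κ : Plane → Matrix (Fin 2) (Fin 2) ℝ)
    (κh : Fin T.m → Matrix (Fin 2) (Fin 2) (MvPolynomial (Fin 2) ℝ))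
    (σ : Plane → Plane) (σs : Fin T.m → PolyField) (S : Set Plane) : ℝ :=
  l2norm S (fun x => σ x - T.glue (fun i => polyField (σs i)) x) ^ 2 +
    l2norm S (T.glue fun i x => app ((κ x)⁻¹ - polyMatrix (κh i) x) (polyField (σs i) x)) ^ 2

end MixedVEM

end

open MixedVEM

/-!
The field `ζ` has no rotation, so a test function `φ` gives `∫ ζ · curl φ = 0`, and Green's formula
on the elements turns `∫ (ζ - ζ_h) · curl φ` into the residuals of `ζ_h` tested with `φ`. Choosing
`φ` as the residual itself times a smooth bump function bounds the residual by the error, once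
norms of polynomials of a fixed degree are known to be equivalent with constants independent of the
mesh (`exists_polyFun_sq_le_scaled`, `exists_polynomial_sq_le`).

* For `rot ζ_h` on an element, the bump lives on the ball with respect to which the element is
  star-shaped (`exists_rot_bound`); no integration up to the boundary is needed.
* For the jump across an edge, star-shapedness shows that the line through an edge misses that ball,
  so that a box attached to the middle of the edge, of size comparable with the edge, lies in the
  element (`Element.IsEdge.hasLeftBox`). Two elements cannot have a box on the same side, so the two
  neighbours of an interior edge lie on opposite sides and the two boxes together with the edge form
  a neighbourhood of the middle of the edge inside the patch. This replaces any appeal to the Jordan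
  curve theorem. The jump is extended constantly in the normal direction, multiplied by a bump of
  the box, and Green's formula is only needed on half planes (`integral_halfPlane_inner_curl`,
  `integral_jump_eq`, `exists_jump_bound_of_sides`).

For the mixed method, rotations `curl φ` of test functions are admissible divergence-free fluxes, so
the first equation says that `κ⁻¹ σ` has no rotation (`IsMixedSolution.hasWeakRot`). The indicators
are the residuals of `κ_h σ_h^⋆` for `ζ = κ⁻¹ σ`, and `ζ - κ_h σ_h^⋆` is split into
`κ⁻¹ (σ - σ_h^⋆)` and `(κ⁻¹ - κ_h) σ_h^⋆` (`IsDiffusion.exists_errOscSq_bound`).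
-/

namespace MixedVEM

/-! ### Polynomials as functions on the plane -/


lemma polyFun_add (p q : MvPolynomial (Fin 2) ℝ) (x : Plane) :
    polyFun (p + q) x = polyFun p x + polyFun q x := by simp [polyFun]

lemma polyFun_sub (p q : MvPolynomial (Fin 2) ℝ) (x : Plane) :
    polyFun (p - q) x = polyFun p x - polyFun q x := by simp [polyFun]

lemma polyFun_mul (p q : MvPolynomial (Fin 2) ℝ) (x : Plane) :
    polyFun (p * q) x = polyFun p x * polyFun q x := by simp [polyFun]

lemma polyFun_smul (c : ℝ) (p : MvPolynomial (Fin 2) ℝ) (x : Plane) :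
    polyFun (c • p) x = c * polyFun p x := by simp [polyFun]

@[simp] lemma polyFun_zero (x : Plane) : polyFun 0 x = 0 := by simp [polyFun]

lemma hasFDerivAt_polyFun (p : MvPolynomial (Fin 2) ℝ) (x : Plane) :
    HasFDerivAt (polyFun p)
      (∑ i, polyFun (MvPolynomial.pderiv i p) x • (EuclideanSpace.proj i : Plane →L[ℝ] ℝ)) x := by
  induction p using MvPolynomial.induction_on with
  | C a =>
    have h : polyFun (MvPolynomial.C a) = fun _ : Plane => a := by ext y; simp [polyFun]
    simpa [h] using hasFDerivAt_const (𝕜 := ℝ) a x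
  | add p q hp hq =>
    convert! hp.add hq using 1
    · ext y; exact polyFun_add p q y
    · simp [polyFun_add, add_smul, Finset.sum_add_distrib]
  | mul_X p n hp =>
    have hX : HasFDerivAt (polyFun (MvPolynomial.X n))
        (EuclideanSpace.proj n : Plane →L[ℝ] ℝ) x := by
      convert! (EuclideanSpace.proj n : Plane →L[ℝ] ℝ).hasFDerivAt using 1
      ext y; simp [polyFun]
    convert! hp.mul hX using 1
    · ext y; exact polyFun_mul p _ y
    · ext v
      simp only [Derivation.leibniz, MvPolynomial.pderiv_X, polyFun_add, smul_eq_mul, polyFun_mul,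
        Fin.sum_univ_two]
      fin_cases n <;> simp [polyFun] <;> ring

lemma pd_polyFun (p : MvPolynomial (Fin 2) ℝ) (i : Fin 2) (x : Plane) :
    pd i (polyFun p) x = polyFun (MvPolynomial.pderiv i p) x := by
  rw [pd, (hasFDerivAt_polyFun p x).fderiv]
  fin_cases i <;> simp

lemma contDiff_polyFun (p : MvPolynomial (Fin 2) ℝ) : ContDiff ℝ ∞ (polyFun p) := by
  induction p using MvPolynomial.induction_on with
  | C a =>
    have h : polyFun (MvPolynomial.C a) = fun _ : Plane => a := by ext y; simp [polyFun]
    rw [h]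
    exact contDiff_const
  | add p q hp hq =>
    convert! hp.add hq using 1
    ext y; exact polyFun_add p q y
  | mul_X p n hp =>
    have hX : ContDiff ℝ ∞ (polyFun (MvPolynomial.X n)) := by
      convert! (EuclideanSpace.proj n : Plane →L[ℝ] ℝ).contDiff using 1
      ext y; simp [polyFun]
    convert! hp.mul hX using 1
    ext y; exact polyFun_mul p _ y

lemma continuous_polyFun (p : MvPolynomial (Fin 2) ℝ) : Continuous (polyFun p) :=
  (contDiff_polyFun p).continuous

/-- Substitution of polynomials of degree at most one does not raise the total degree. -/
lemma totalDegree_bind₁_le_of_affine (p : MvPolynomial (Fin 2) ℝ)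
    (f : Fin 2 → MvPolynomial (Fin 2) ℝ) (hf : ∀ i, (f i).totalDegree ≤ 1) :
    (MvPolynomial.bind₁ f p).totalDegree ≤ p.totalDegree := by
  rw [MvPolynomial.bind₁, MvPolynomial.aeval_def, MvPolynomial.eval₂_eq]
  refine MvPolynomial.totalDegree_finsetSum_le fun d hd => ?_
  refine (MvPolynomial.totalDegree_mul _ _).trans ?_
  have h1 : (∏ i ∈ d.support, f i ^ d i).totalDegree ≤ ∑ i ∈ d.support, d i := by
    refine (MvPolynomial.totalDegree_finsetProd _ _).trans (Finset.sum_le_sum fun i _ => ?_)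
    refine (MvPolynomial.totalDegree_pow _ _).trans ?_
    simpa using Nat.mul_le_mul_left (d i) (hf i)
  have h2 : (∑ i ∈ d.support, d i) ≤ p.totalDegree := MvPolynomial.le_totalDegree hd
  simp only [MvPolynomial.algebraMap_eq, MvPolynomial.totalDegree_C, zero_add]
  exact h1.trans h2

/-- A polynomial in the scaled variable `y`, where `x = x₀ + h y`. -/
lemma exists_rescaled (p : MvPolynomial (Fin 2) ℝ) (x₀ : Plane) (h : ℝ) :
    ∃ p' : MvPolynomial (Fin 2) ℝ, p'.totalDegree ≤ p.totalDegree ∧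
      ∀ y, polyFun p' y = polyFun p (x₀ + h • y) := by
  refine ⟨MvPolynomial.bind₁
    (fun i => MvPolynomial.C (x₀ i) + MvPolynomial.C h * MvPolynomial.X i) p,
    totalDegree_bind₁_le_of_affine _ _ fun i => ?_, fun y => ?_⟩
  · refine (MvPolynomial.totalDegree_add _ _).trans (max_le (by simp) ?_)
    exact (MvPolynomial.totalDegree_mul _ _).trans (by simp)
  · simp only [polyFun]
    induction p using MvPolynomial.induction_on with
    | C a => simp
    | add p q hp hq => simp [hp, hq]
    | mul_X p n hp => simp [hp]

/-- The restriction of a polynomial of two variables to a line is a polynomial of the parameter. -/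
lemma exists_restrict_line (p : MvPolynomial (Fin 2) ℝ) (a w : Plane) :
    ∃ P : Polynomial ℝ, P.natDegree ≤ p.totalDegree ∧
      ∀ t : ℝ, P.eval t = polyFun p (a + t • w) := by
  refine ⟨MvPolynomial.aeval
    (fun i => Polynomial.C (a i) + Polynomial.C (w i) * Polynomial.X) p, ?_, fun t => ?_⟩
  · have := MvPolynomial.aeval_natDegree_le p le_rfl
      (fun i => Polynomial.C (a i) + Polynomial.C (w i) * Polynomial.X) (n := 1) (fun i => by
        compute_degree)
    simpa using this
  · simp only [polyFun]
    induction p using MvPolynomial.induction_on with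
    | C a => simp
    | add p q hp hq => rw [map_add, map_add, Polynomial.eval_add, hp, hq]
    | mul_X p n hp =>
      rw [map_mul, map_mul, Polynomial.eval_mul, hp]
      simp [mul_comm t]

/-! ### Equivalence of norms on spaces of polynomials -/

/-- On a finite-dimensional space of functions, a weighted `L²` norm that vanishes only at `0`
controls the values of any other continuous linear evaluation on a compact set: the evaluation is a
linear map on a finite-dimensional inner product space, hence bounded. -/
lemma exists_sq_le_integral {V X : Type*} [AddCommGroup V] [Module ℝ V] [FiniteDimensional ℝ V]
    [TopologicalSpace X] [MeasurableSpace X] [OpensMeasurableSpace X]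
    (μ : Measure X) [IsFiniteMeasureOnCompacts μ] [μ.IsOpenPosMeasure]
    (ev ev' : V →ₗ[ℝ] X → ℝ) (hev : ∀ v, Continuous (ev v)) (hev' : ∀ v, Continuous (ev' v))
    (w : X → ℝ) (hw : Continuous w) (hws : HasCompactSupport w) (hw0 : ∀ x, 0 ≤ w x)
    (hinj : ∀ v, (∀ x, 0 < w x → ev v x = 0) → v = 0) (K : Set X) (hK : IsCompact K) :
    ∃ C : ℝ, 0 < C ∧ ∀ v, ∀ x ∈ K, ev' v x ^ 2 ≤ C * ∫ y, w y * ev v y ^ 2 ∂μ := by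
  have hint : ∀ u v, Integrable (fun y => w y * (ev u y * ev v y)) μ := fun u v =>
    (hw.mul ((hev u).mul (hev v))).integrable_of_hasCompactSupport hws.mul_right
  let core : InnerProductSpace.Core ℝ V :=
    { inner := fun u v => ∫ y, w y * (ev u y * ev v y) ∂μ
      conj_inner_symm := fun u v => by
        simp only [conj_trivial]
        congr 1; ext y; ring
      re_inner_nonneg := fun u => by
        simp only [RCLike.re_to_real]
        exact integral_nonneg fun y => mul_nonneg (hw0 y) (mul_self_nonneg _)
      add_left := fun u v z => by
        rw [← integral_add (hint _ _) (hint _ _)]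
        congr 1; ext y; simp; ring
      smul_left := fun u v r => by
        simp only [conj_trivial]
        rw [← integral_const_mul]
        congr 1; ext y; simp; ring
      definite := fun u hu => by
        refine hinj u fun x hx => ?_
        by_contra hne
        have hpos := Continuous.integral_pos_of_hasCompactSupport_nonneg_nonzero (μ := μ) (x := x)
          (hw.mul ((hev u).mul (hev u))) hws.mul_right
          (fun y => mul_nonneg (hw0 y) (mul_self_nonneg _))
          (mul_pos hx (mul_self_pos.2 hne)).ne'
        exact hpos.ne' hu }
  let _ : NormedAddCommGroup V := core.toNormedAddCommGroup
  let _ : InnerProductSpace ℝ V := InnerProductSpace.ofCore core.toCore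
  have : CompactSpace K := isCompact_iff_compactSpace.1 hK
  let T : V →ₗ[ℝ] C(K, ℝ) :=
    { toFun := fun v => ⟨fun x => ev' v x, (hev' v).comp continuous_subtype_val⟩
      map_add' := fun u v => by ext; simp
      map_smul' := fun c v => by ext; simp }
  let T' : V →L[ℝ] C(K, ℝ) := LinearMap.toContinuousLinearMap T
  refine ⟨‖T'‖ ^ 2 + 1, by positivity, fun v x hx => ?_⟩
  have h1 : |ev' v x| ≤ ‖T'‖ * ‖v‖ :=
    ((T' v).norm_coe_le_norm ⟨x, hx⟩).trans (T'.le_opNorm v)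
  have h2 : ‖v‖ ^ 2 = ∫ y, w y * ev v y ^ 2 ∂μ := by
    rw [← real_inner_self_eq_norm_sq]
    change ∫ y, w y * (ev v y * ev v y) ∂μ = _
    congr 1; ext y; ring
  rw [← h2, ← sq_abs]
  calc |ev' v x| ^ 2 ≤ (‖T'‖ * ‖v‖) ^ 2 := by gcongr
    _ ≤ (‖T'‖ ^ 2 + 1) * ‖v‖ ^ 2 := by nlinarith [sq_nonneg ‖v‖]

/-- Norm equivalence and inverse inequality on the unit ball, for a weight that may be concentrated
near the centre. -/
lemma exists_polyFun_sq_le (k : ℕ) (w : Plane → ℝ) (hw : Continuous w)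
    (hws : HasCompactSupport w) (hw0 : ∀ x, 0 ≤ w x) (hpos : 0 < w 0) :
    ∃ C : ℝ, 0 < C ∧ ∀ p : MvPolynomial (Fin 2) ℝ, p.totalDegree ≤ k →
      ∀ y ∈ Metric.closedBall (0 : Plane) 1,
        polyFun p y ^ 2 ≤ C * ∫ z, w z * polyFun p z ^ 2 ∧
        ∀ i, polyFun (MvPolynomial.pderiv i p) y ^ 2 ≤ C * ∫ z, w z * polyFun p z ^ 2 := by
  let V := MvPolynomial.restrictTotalDegree (Fin 2) ℝ k
  let ev (D : MvPolynomial (Fin 2) ℝ →ₗ[ℝ] MvPolynomial (Fin 2) ℝ) : V →ₗ[ℝ] Plane → ℝ :=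
    { toFun := fun p => polyFun (D p)
      map_add' := fun p q => by ext x; simp [polyFun_add]
      map_smul' := fun c p => by ext x; simp [polyFun_smul] }
  have hinj : ∀ v : V, (∀ x, 0 < w x → ev LinearMap.id v x = 0) → v = 0 := by
    intro v hv
    have hnhds : ∀ᶠ x in nhds (0 : Plane), 0 < w x := hw.continuousAt.eventually (lt_mem_nhds hpos)
    obtain ⟨ε, hε, hball⟩ := Metric.eventually_nhds_iff_ball.1 hnhds
    have hz : (v : MvPolynomial (Fin 2) ℝ) = 0 := by
      refine MvPolynomial.funext_set (fun _ => Ioo (-(ε / 2)) (ε / 2))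
        (fun _ => Ioo_infinite (by linarith)) fun x hx => ?_
      have h0 := hx 0 trivial
      have h1 := hx 1 trivial
      have := hv (WithLp.toLp 2 x) (hball _ ?_)
      · simpa [ev, polyFun] using this
      · rw [mem_ball_zero_iff, EuclideanSpace.norm_eq, Real.sqrt_lt' hε]
        simp only [Fin.sum_univ_two, Real.norm_eq_abs, sq_abs]
        have e0 : x 0 ^ 2 < (ε / 2) ^ 2 := sq_lt_sq' h0.1 h0.2
        have e1 : x 1 ^ 2 < (ε / 2) ^ 2 := sq_lt_sq' h1.1 h1.2
        nlinarith
    exact Subtype.ext hz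
  have key := fun D => exists_sq_le_integral volume (ev LinearMap.id) (ev D)
    (fun v => continuous_polyFun _) (fun v => continuous_polyFun _) w hw hws hw0 hinj
    (Metric.closedBall 0 1) (isCompact_closedBall _ _)
  obtain ⟨C, hC, h⟩ := key LinearMap.id
  choose C' hC' h' using fun i : Fin 2 => key (MvPolynomial.pderiv (R := ℝ) i).toLinearMap
  refine ⟨C + C' 0 + C' 1, by linarith [hC' 0, hC' 1], fun p hp y hy => ?_⟩
  let v : V := ⟨p, (MvPolynomial.mem_restrictTotalDegree _ _ _).2 hp⟩
  have hI : 0 ≤ ∫ z, w z * polyFun p z ^ 2 :=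
    integral_nonneg fun z => mul_nonneg (hw0 z) (sq_nonneg _)
  have n1 := mul_nonneg hC.le hI
  have n2 := fun i => mul_nonneg (hC' i).le hI
  have m1 : polyFun p y ^ 2 ≤ C * ∫ z, w z * polyFun p z ^ 2 := h v y hy
  have m2 : ∀ i, polyFun (MvPolynomial.pderiv i p) y ^ 2 ≤ C' i * ∫ z, w z * polyFun p z ^ 2 :=
    fun i => h' i v y hy
  refine ⟨by linarith [n2 0, n2 1], Fin.forall_fin_two.2 ⟨?_, ?_⟩⟩
  · linarith [n2 1, m2 0]
  · linarith [n2 0, m2 1]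

/-- The scaled form of the norm equivalence: the constant depends on the degree only, not on the
centre and the radius of the ball. The powers of `h` come from the area element and from the chain
rule. -/
lemma exists_polyFun_sq_le_scaled (k : ℕ) (w : Plane → ℝ) (hw : Continuous w)
    (hws : HasCompactSupport w) (hw0 : ∀ x, 0 ≤ w x) (hpos : 0 < w 0) :
    ∃ C : ℝ, 0 < C ∧ ∀ p : MvPolynomial (Fin 2) ℝ, p.totalDegree ≤ k →
      ∀ (x₀ : Plane) (h : ℝ), 0 < h → ∀ x ∈ Metric.closedBall x₀ h,
        h ^ 2 * polyFun p x ^ 2 ≤ C * ∫ z, w (h⁻¹ • (z - x₀)) * polyFun p z ^ 2 ∧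
        ∀ i, h ^ 4 * polyFun (MvPolynomial.pderiv i p) x ^ 2 ≤
          C * ∫ z, w (h⁻¹ • (z - x₀)) * polyFun p z ^ 2 := by
  obtain ⟨C, hC, H⟩ := exists_polyFun_sq_le k w hw hws hw0 hpos
  refine ⟨C, hC, fun p hp x₀ h hh x hx => ?_⟩
  obtain ⟨p', hp', hpp'⟩ := exists_rescaled p x₀ h
  have hint : ∫ z, w (h⁻¹ • (z - x₀)) * polyFun p z ^ 2 =
      h ^ 2 * ∫ z, w z * polyFun p' z ^ 2 := by
    rw [← integral_add_left_eq_self (fun z => w (h⁻¹ • (z - x₀)) * polyFun p z ^ 2) x₀]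
    have := Measure.integral_comp_inv_smul volume (fun z => w z * polyFun p' z ^ 2) h
    simp only [finrank_euclideanSpace, Fintype.card_fin, abs_of_pos (pow_pos hh 2),
      smul_eq_mul] at this
    rw [← this]
    congr 1; ext z
    rw [hpp', smul_inv_smul₀ hh.ne', add_sub_cancel_left]
  set y := h⁻¹ • (x - x₀) with hy
  have hxy : x = x₀ + h • y := by rw [hy, smul_inv_smul₀ hh.ne']; abel
  have hyb : y ∈ Metric.closedBall (0 : Plane) 1 := by
    rw [mem_closedBall_zero_iff, hy, norm_smul, norm_inv, Real.norm_of_nonneg hh.le,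
      inv_mul_le_iff₀ hh, mul_one, ← dist_eq_norm]
    exact hx
  obtain ⟨h1, h2⟩ := H p' (hp'.trans hp) y hyb
  have hder : ∀ i, polyFun (MvPolynomial.pderiv i p') y
      = h * polyFun (MvPolynomial.pderiv i p) x := by
    intro i
    have hf : polyFun p' = fun y => polyFun p (x₀ + h • y) := funext hpp'
    have hA : HasFDerivAt (fun y : Plane => x₀ + h • y) (h • ContinuousLinearMap.id ℝ Plane) y :=
      ((hasFDerivAt_id y).const_smul h).const_add x₀
    have hp2 := hasFDerivAt_polyFun p (x₀ + h • y)
    have hc := hp2.comp y hA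
    rw [← pd_polyFun, ← pd_polyFun, pd, hf, pd, hxy, hp2.fderiv]
    erw [hc.fderiv]
    simp only [ContinuousLinearMap.comp_apply, _root_.smul_apply, map_smul,
      smul_eq_mul, ContinuousLinearMap.id_apply]
  rw [hint]
  refine ⟨?_, fun i => ?_⟩
  · rw [hpp', ← hxy] at h1
    calc h ^ 2 * polyFun p x ^ 2 ≤ h ^ 2 * (C * ∫ z, w z * polyFun p' z ^ 2) := by gcongr
      _ = _ := by ring
  · have := h2 i
    rw [hder] at this
    calc h ^ 4 * polyFun (MvPolynomial.pderiv i p) x ^ 2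
        = h ^ 2 * (h * polyFun (MvPolynomial.pderiv i p) x) ^ 2 := by ring
      _ ≤ h ^ 2 * (C * ∫ z, w z * polyFun p' z ^ 2) := by gcongr
      _ = _ := by ring

/-- Norm equivalence and inverse inequality for polynomials of one variable on `[0, 1]`. -/
lemma exists_polynomial_sq_le (k : ℕ) (w : ℝ → ℝ) (hw : Continuous w)
    (hws : HasCompactSupport w) (hw0 : ∀ x, 0 ≤ w x) (hpos : ∃ t, 0 < w t) :
    ∃ C : ℝ, 0 < C ∧ ∀ P : Polynomial ℝ, P.natDegree ≤ k → ∀ t ∈ Icc (0 : ℝ) 1,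
      P.eval t ^ 2 ≤ C * ∫ s, w s * P.eval s ^ 2 ∧
      P.derivative.eval t ^ 2 ≤ C * ∫ s, w s * P.eval s ^ 2 := by
  let V := Polynomial.degreeLT ℝ (k + 1)
  have : FiniteDimensional ℝ V := Module.Finite.equiv (Polynomial.degreeLTEquiv ℝ (k + 1)).symm
  let ev (D : Polynomial ℝ →ₗ[ℝ] Polynomial ℝ) : V →ₗ[ℝ] ℝ → ℝ :=
    { toFun := fun p t => (D p).eval t
      map_add' := fun p q => by ext x; simp
      map_smul' := fun c p => by ext x; simp }
  have hinj : ∀ v : V, (∀ x, 0 < w x → ev LinearMap.id v x = 0) → v = 0 := by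
    intro v hv
    obtain ⟨t, ht⟩ := hpos
    have hnhds : {x | 0 < w x} ∈ nhds t := hw.continuousAt.eventually (lt_mem_nhds ht)
    exact Subtype.ext (Polynomial.eq_zero_of_infinite_isRoot _
      ((infinite_of_mem_nhds t hnhds).mono fun x hx => hv x hx))
  have key := fun D => exists_sq_le_integral volume (ev LinearMap.id) (ev D)
    (fun v => Polynomial.continuous _) (fun v => Polynomial.continuous _) w hw hws hw0 hinj
    (Icc 0 1) isCompact_Icc
  obtain ⟨C, hC, h⟩ := key LinearMap.id
  obtain ⟨C', hC', h'⟩ := key Polynomial.derivative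
  refine ⟨C + C', by linarith, fun P hP t ht => ?_⟩
  let v : V := ⟨P, Polynomial.mem_degreeLT.2
    (lt_of_le_of_lt Polynomial.degree_le_natDegree (by exact_mod_cast Nat.lt_succ_of_le hP))⟩
  have hI : 0 ≤ ∫ z, w z * P.eval z ^ 2 :=
    integral_nonneg fun z => mul_nonneg (hw0 z) (sq_nonneg _)
  have n1 := mul_nonneg hC.le hI
  have n2 := mul_nonneg hC'.le hI
  have m1 : P.eval t ^ 2 ≤ C * ∫ z, w z * P.eval z ^ 2 := h v t ht
  have m2 : P.derivative.eval t ^ 2 ≤ C' * ∫ z, w z * P.eval z ^ 2 := h' v t ht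
  exact ⟨by linarith, by linarith⟩

/-! ### Integration by parts -/

lemma inner_plane (x y : Plane) : ⟪x, y⟫ = x 0 * y 0 + x 1 * y 1 := by
  rw [PiLp.inner_apply, Fin.sum_univ_two]
  simp [mul_comm]

lemma fderiv_eq_pd {φ : Plane → ℝ} {x v : Plane} :
    fderiv ℝ φ x v = v 0 * pd 0 φ x + v 1 * pd 1 φ x := by
  have hv : v = v 0 • EuclideanSpace.single (0 : Fin 2) (1 : ℝ)
      + v 1 • EuclideanSpace.single (1 : Fin 2) (1 : ℝ) := by
    ext i; fin_cases i <;> simp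
  conv_lhs => rw [hv]
  simp [pd]

lemma pd_mul {f g : Plane → ℝ} {x : Plane} (hf : DifferentiableAt ℝ f x)
    (hg : DifferentiableAt ℝ g x) (i : Fin 2) :
    pd i (fun y => f y * g y) x = f x * pd i g x + pd i f x * g x := by
  rw [pd, fderiv_fun_mul hf hg]
  simp [pd, mul_comm]

lemma contDiff_pd {φ : Plane → ℝ} (h : ContDiff ℝ ∞ φ) (i : Fin 2) : ContDiff ℝ ∞ (pd i φ) :=
  (h.fderiv_right (m := ∞) (by simp)).clm_apply contDiff_const

lemma hasCompactSupport_pd {φ : Plane → ℝ} (h : HasCompactSupport φ) (i : Fin 2) :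
    HasCompactSupport (pd i φ) := h.fderiv_apply ℝ _

lemma integral_mul_pd {f g : Plane → ℝ} (hf : ContDiff ℝ ∞ f) (hg : ContDiff ℝ ∞ g)
    (hs : HasCompactSupport g) (i : Fin 2) :
    ∫ x, f x * pd i g x = -∫ x, pd i f x * g x :=
  integral_mul_fderiv_eq_neg_fderiv_mul_of_integrable
    (((contDiff_pd hf i).continuous.mul hg.continuous).integrable_of_hasCompactSupport hs.mul_left)
    ((hf.continuous.mul (contDiff_pd hg i).continuous).integrable_of_hasCompactSupport
      (hasCompactSupport_pd hs i).mul_left)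
    ((hf.continuous.mul hg.continuous).integrable_of_hasCompactSupport hs.mul_left)
    (fun x _ => hf.differentiable (by simp) x) (fun x _ => hg.differentiable (by simp) x)

lemma inner_curl (v : Plane) (φ : Plane → ℝ) (x : Plane) :
    ⟪v, curl φ x⟫ = v 0 * pd 1 φ x - v 1 * pd 0 φ x := by
  rw [inner_plane]; simp [curl]; ring

lemma continuous_polyField (q : PolyField) : Continuous (polyField q) :=
  (PiLp.continuous_toLp 2 _).comp (continuous_pi fun i => continuous_polyFun (q i))

lemma polyFun_polyRot (q : PolyField) (x : Plane) :
    polyFun (polyRot q) x = pd 0 (polyFun (q 1)) x - pd 1 (polyFun (q 0)) x := by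
  rw [polyRot, polyFun_sub, pd_polyFun, pd_polyFun]

lemma continuous_curl {φ : Plane → ℝ} (h : ContDiff ℝ ∞ φ) : Continuous (curl φ) := by
  refine (PiLp.continuous_toLp 2 _).comp (continuous_pi fun i => ?_)
  fin_cases i
  · exact (contDiff_pd h 1).continuous
  · exact (contDiff_pd h 0).continuous.neg

lemma curl_eq_zero_of_notMem {φ : Plane → ℝ} {x : Plane} (hx : x ∉ tsupport φ) :
    curl φ x = 0 := by
  have h : ∀ i, pd i φ x = 0 := fun i => by
    have : fderiv ℝ φ x = 0 :=
      image_eq_zero_of_notMem_tsupport fun hh => hx (tsupport_fderiv_subset ℝ hh)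
    simp [pd, this]
  ext i; fin_cases i <;> simp [curl, h]

lemma hasCompactSupport_curl {φ : Plane → ℝ} (h : HasCompactSupport φ) :
    HasCompactSupport (curl φ) :=
  HasCompactSupport.intro h fun _ hx => curl_eq_zero_of_notMem hx

/-- Green's formula for a polynomial field and a test function on the whole plane. -/
lemma integral_inner_curl (q : PolyField) {φ : Plane → ℝ} (hφ : ContDiff ℝ ∞ φ)
    (hs : HasCompactSupport φ) :
    ∫ x, ⟪polyField q x, curl φ x⟫ = ∫ x, polyFun (polyRot q) x * φ x := by
  have hq := fun i => contDiff_polyFun (q i)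
  have i1 : ∀ i j, Integrable fun x => polyFun (q i) x * pd j φ x := fun i j =>
    ((hq i).continuous.mul (contDiff_pd hφ j).continuous).integrable_of_hasCompactSupport
      (hasCompactSupport_pd hs j).mul_left
  have i2 : ∀ i j, Integrable fun x => pd j (polyFun (q i)) x * φ x := fun i j =>
    ((contDiff_pd (hq i) j).continuous.mul hφ.continuous).integrable_of_hasCompactSupport
      hs.mul_left
  simp only [inner_curl, polyFun_polyRot, sub_mul, polyField]
  rw [integral_sub (i1 0 1) (i1 1 0), integral_sub (i2 1 0) (i2 0 1),
    integral_mul_pd (hq 0) hφ hs, integral_mul_pd (hq 1) hφ hs]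
  ring

/-- Rotation by a right angle. -/
def rot90 (v : Plane) : Plane := !₂[-v 1, v 0]

lemma inner_rot90 (x v : Plane) : ⟪x, rot90 v⟫ = x 1 * v 0 - x 0 * v 1 := by
  rw [inner_plane]; simp [rot90]; ring

/-- The open half plane on the left of the oriented line through `a` with direction `s`. -/
def halfPlane (a s : Plane) : Set Plane := {x | 0 < ⟪x - a, rot90 s⟫}

lemma isOpen_halfPlane (a s : Plane) : IsOpen (halfPlane a s) :=
  isOpen_lt continuous_const (by fun_prop)

lemma measurableSet_halfPlane (a s : Plane) : MeasurableSet (halfPlane a s) :=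
  (isOpen_halfPlane a s).measurableSet

lemma norm_sq_plane (s : Plane) : ‖s‖ ^ 2 = s 0 ^ 2 + s 1 ^ 2 := by
  rw [EuclideanSpace.norm_sq_eq, Fin.sum_univ_two]; simp

lemma norm_rot90 (s : Plane) : ‖rot90 s‖ = ‖s‖ := by
  rw [← sq_eq_sq₀ (norm_nonneg _) (norm_nonneg _), norm_sq_plane, norm_sq_plane]
  simp [rot90]; ring

/-- The rigid motion that maps the coordinates `(u, v)` to `a + u s + v n`, where `n` is the unit
vector `s` turned by a right angle, preserves the area. -/
lemma measurePreserving_frame (a : Plane) {s : Plane} (hs : ‖s‖ = 1) :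
    MeasurePreserving (fun p : ℝ × ℝ => a + p.1 • s + p.2 • rot90 s) volume volume ∧
      MeasurableEmbedding (fun p : ℝ × ℝ => a + p.1 • s + p.2 • rot90 s) := by
  have hs2 : s 0 * s 0 + s 1 * s 1 = 1 := by
    have := norm_sq_plane s; rw [hs] at this; linarith
  have hon : Orthonormal ℝ (![s, rot90 s] : Fin 2 → Plane) := by
    rw [orthonormal_iff_ite]
    intro i j
    have hr : ‖rot90 s‖ = 1 := (norm_rot90 s).trans hs
    have h0 : ⟪s, rot90 s⟫ = 0 := by rw [inner_rot90]; ring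
    fin_cases i <;> fin_cases j <;> simp [hs, hr, h0, real_inner_comm]
  obtain ⟨b, hb⟩ := Orthonormal.exists_orthonormalBasis_extension_of_card_eq
    (v := (![s, rot90 s] : Fin 2 → Plane)) (s := univ) (by simp)
    (hon.comp _ Subtype.val_injective)
  have e1 : MeasurePreserving (fun x : Plane => a + x) volume volume :=
    measurePreserving_add_left _ a
  have e2 := (e1.comp b.measurePreserving_repr_symm).comp
    ((PiLp.volume_preserving_toLp (Fin 2)).comp (volume_preserving_finTwoArrow ℝ).symm)
  have heq : (fun p : ℝ × ℝ => a + p.1 • s + p.2 • rot90 s) =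
      ((fun x : Plane => a + x) ∘ b.repr.symm) ∘
        (WithLp.toLp 2 ∘ (MeasurableEquiv.finTwoArrow (α := ℝ)).symm) := by
    ext1 p
    simp only [Function.comp_apply]
    rw [← b.sum_repr_symm, Fin.sum_univ_two, hb 0 trivial, hb 1 trivial, add_assoc]
    simp [MeasurableEquiv.finTwoArrow]
  refine ⟨heq ▸ e2, Continuous.measurableEmbedding (by fun_prop) fun p p' h => ?_⟩
  have h0 := congrFun (congrArg WithLp.ofLp h) 0
  have h1 := congrFun (congrArg WithLp.ofLp h) 1
  simp [rot90] at h0 h1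
  ext
  · linear_combination s 0 * h0 + s 1 * h1 - (p.1 - p'.1) * hs2
  · linear_combination -s 1 * h0 + s 0 * h1 - (p.2 - p'.2) * hs2

lemma setIntegral_halfPlane (a : Plane) {s : Plane} (hs : ‖s‖ = 1) (F : Plane → ℝ) :
    ∫ x in halfPlane a s, F x =
      ∫ p : ℝ × ℝ, F (a + p.1 • s + p.2 • rot90 s) ∂(volume.prod (volume.restrict (Ioi 0))) := by
  obtain ⟨h1, h2⟩ := measurePreserving_frame a hs
  rw [← h1.setIntegral_preimage_emb h2]
  have hs2 : s 0 * s 0 + s 1 * s 1 = 1 := by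
    have := norm_sq_plane s; rw [hs] at this; linarith
  have hpre : (fun p : ℝ × ℝ => a + p.1 • s + p.2 • rot90 s) ⁻¹' (halfPlane a s) =
      univ ×ˢ Ioi 0 := by
    ext p
    have : ⟪a + p.1 • s + p.2 • rot90 s - a, rot90 s⟫ = p.2 := by
      rw [inner_rot90]; simp [rot90]; linear_combination p.2 * hs2
    simp [halfPlane, this]
  rw [hpre, Measure.volume_eq_prod, ← Measure.prod_restrict, Measure.restrict_univ]

lemma integrable_frame (a : Plane) {s : Plane} (hs : ‖s‖ = 1) {F : Plane → ℝ}
    (hF : Integrable F) :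
    Integrable (fun p : ℝ × ℝ => F (a + p.1 • s + p.2 • rot90 s))
      (volume.prod (volume.restrict (Ioi 0))) := by
  obtain ⟨h1, h2⟩ := measurePreserving_frame a hs
  have : Integrable (F ∘ fun p : ℝ × ℝ => a + p.1 • s + p.2 • rot90 s) volume :=
    (h1.integrable_comp_emb h2).2 hF
  have h3 := this.integrableOn (s := univ ×ˢ Ioi (0 : ℝ))
  rwa [IntegrableOn, Measure.volume_eq_prod, ← Measure.prod_restrict, Measure.restrict_univ] at h3

lemma isClosedEmbedding_line (a : Plane) {s : Plane} (hs : ‖s‖ = 1) :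
    Topology.IsClosedEmbedding fun t : ℝ => a + t • s := by
  refine Isometry.isClosedEmbedding (Isometry.of_dist_eq fun x y => ?_)
  rw [dist_add_left, dist_eq_norm, ← sub_smul, norm_smul, hs, mul_one, Real.dist_eq,
    Real.norm_eq_abs]

lemma deriv_comp_line {g : Plane → ℝ} (hg : ContDiff ℝ ∞ g) (a s : Plane) (t : ℝ) :
    HasDerivAt (fun t : ℝ => g (a + t • s)) (fderiv ℝ g (a + t • s) s) t := by
  have h1 : HasDerivAt (fun t : ℝ => a + t • s) s t := by
    simpa using ((hasDerivAt_id t).smul_const s).const_add a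
  exact ((hg.differentiable (by simp) _).hasFDerivAt).comp_hasDerivAt t h1

/-- A tangential derivative has no integral over a half plane. -/
lemma integral_halfPlane_tangential {g : Plane → ℝ} (hg : ContDiff ℝ ∞ g)
    (hc : HasCompactSupport g) (a : Plane) {s : Plane} (hs : ‖s‖ = 1) :
    ∫ x in halfPlane a s, fderiv ℝ g x s = 0 := by
  have hgi : Integrable fun x => fderiv ℝ g x s :=
    ((hg.continuous_fderiv (by simp)).clm_apply continuous_const).integrable_of_hasCompactSupport
      (hc.fderiv_apply ℝ s)
  rw [setIntegral_halfPlane a hs, integral_prod_symm _ (integrable_frame a hs hgi)]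
  refine integral_eq_zero_of_ae (Filter.Eventually.of_forall fun v => ?_)
  have hE := isClosedEmbedding_line (a + v • rot90 s) hs
  have := integral_eq_zero_of_hasDerivAt_of_integrable
    (fun t => deriv_comp_line hg (a + v • rot90 s) s t)
    ((((hg.continuous_fderiv (by simp)).clm_apply continuous_const).comp
      hE.continuous).integrable_of_hasCompactSupport
        ((hc.fderiv_apply ℝ s).comp_isClosedEmbedding hE))
    ((hg.continuous.comp hE.continuous).integrable_of_hasCompactSupport
      (hc.comp_isClosedEmbedding hE))
  refine Eq.trans (integral_congr_ae (Filter.Eventually.of_forall fun t => ?_)) this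
  simp only [add_right_comm]

/-- The integral of a normal derivative over a half plane is a boundary integral. -/
lemma integral_halfPlane_normal {g : Plane → ℝ} (hg : ContDiff ℝ ∞ g)
    (hc : HasCompactSupport g) (a : Plane) {s : Plane} (hs : ‖s‖ = 1) :
    ∫ x in halfPlane a s, fderiv ℝ g x (rot90 s) = -∫ u : ℝ, g (a + u • s) := by
  have hgi : Integrable fun x => fderiv ℝ g x (rot90 s) :=
    ((hg.continuous_fderiv (by simp)).clm_apply continuous_const).integrable_of_hasCompactSupport
      (hc.fderiv_apply ℝ (rot90 s))
  rw [setIntegral_halfPlane a hs, integral_prod _ (integrable_frame a hs hgi), ← integral_neg]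
  refine integral_congr_ae (Filter.Eventually.of_forall fun u => ?_)
  have hE := isClosedEmbedding_line (a + u • s) ((norm_rot90 s).trans hs)
  have h1 : ContDiff ℝ ∞ fun t : ℝ => g (a + u • s + t • rot90 s) := by fun_prop
  have := HasCompactSupport.integral_Ioi_deriv_eq (h1.of_le (by simp))
    (hc.comp_isClosedEmbedding hE) 0
  simp only [zero_smul, add_zero] at this
  refine Eq.trans ?_ this
  refine integral_congr_ae (Filter.Eventually.of_forall fun t => ?_)
  exact (deriv_comp_line hg _ _ t).deriv.symm

/-- Green's formula for a polynomial field and a test function on a half plane. In the frame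
`(s, n)` with `n = rot90 s`, the rotation of `φ q` is `∂_s (φ q · n) - ∂_n (φ q · s)`. -/
lemma integral_halfPlane_inner_curl (q : PolyField) {φ : Plane → ℝ} (hφ : ContDiff ℝ ∞ φ)
    (hc : HasCompactSupport φ) (a : Plane) {s : Plane} (hs : ‖s‖ = 1) :
    ∫ x in halfPlane a s, ⟪polyField q x, curl φ x⟫ =
      (∫ x in halfPlane a s, polyFun (polyRot q) x * φ x) -
        ∫ u : ℝ, φ (a + u • s) * ⟪polyField q (a + u • s), s⟫ := by
  have hs2 : s 0 * s 0 + s 1 * s 1 = 1 := by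
    have := norm_sq_plane s; rw [hs] at this; linarith
  have hq := fun i => contDiff_polyFun (q i)
  -- `∂_v (φ q · w)` for constant vectors `v` and `w`
  have hcomp : ∀ w v x, fderiv ℝ (fun y => φ y * ⟪polyField q y, w⟫) x v =
      ∑ i : Fin 2, ∑ j : Fin 2, w i * v j *
        (φ x * pd j (polyFun (q i)) x + pd j φ x * polyFun (q i) x) := by
    intro w v x
    have hd : ∀ i, DifferentiableAt ℝ (polyFun (q i)) x := fun i =>
      (hq i).differentiable (by simp) x
    have hφd : DifferentiableAt ℝ φ x := hφ.differentiable (by simp) x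
    have hf : (fun y => φ y * ⟪polyField q y, w⟫) =
        fun y => w 0 * (φ y * polyFun (q 0) y) + w 1 * (φ y * polyFun (q 1) y) := by
      ext y; rw [inner_plane]; simp [polyField]; ring
    rw [hf, fderiv_fun_add ((hφd.fun_mul (hd 0)).const_mul _) ((hφd.fun_mul (hd 1)).const_mul _),
      fderiv_const_mul (hφd.fun_mul (hd 0)), fderiv_const_mul (hφd.fun_mul (hd 1))]
    simp only [_root_.add_apply, _root_.smul_apply, smul_eq_mul, fderiv_eq_pd, pd_mul hφd (hd _),
      Fin.sum_univ_two]
    ring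
  have hsm : ∀ w : Plane, ContDiff ℝ ∞ fun y => φ y * ⟪polyField q y, w⟫ := by
    intro w
    simp only [inner_plane, polyField]
    exact hφ.mul (((hq 0).mul contDiff_const).add ((hq 1).mul contDiff_const))
  have hcs : ∀ w : Plane, HasCompactSupport fun y => φ y * ⟪polyField q y, w⟫ := fun w =>
    hc.mul_right
  have hpt : ∀ x, ⟪polyField q x, curl φ x⟫ = polyFun (polyRot q) x * φ x -
      (fderiv ℝ (fun y => φ y * ⟪polyField q y, rot90 s⟫) x s -
        fderiv ℝ (fun y => φ y * ⟪polyField q y, s⟫) x (rot90 s)) := by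
    intro x
    rw [hcomp, hcomp, inner_curl, polyFun_polyRot]
    simp only [Fin.sum_univ_two, rot90, polyField]
    simp
    linear_combination (φ x * (pd 0 (polyFun (q 1)) x - pd 1 (polyFun (q 0)) x)
      + pd 0 φ x * polyFun (q 1) x - pd 1 φ x * polyFun (q 0) x) * hs2
  have hI : ∀ w v : Plane, Integrable fun x => fderiv ℝ (fun y => φ y * ⟪polyField q y, w⟫) x v :=
    fun w v => (((hsm w).continuous_fderiv (by simp)).clm_apply
      continuous_const).integrable_of_hasCompactSupport ((hcs w).fderiv_apply ℝ v)
  have hI0 : Integrable fun x => polyFun (polyRot q) x * φ x :=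
    ((continuous_polyFun _).mul hφ.continuous).integrable_of_hasCompactSupport hc.mul_left
  have hI1 := (hI (rot90 s) s).integrableOn (s := halfPlane a s)
  have hI2 := (hI s (rot90 s)).integrableOn (s := halfPlane a s)
  simp only [hpt]
  have e1 := integral_sub hI0.integrableOn (hI1.sub hI2)
  simp only [Pi.sub_apply] at e1
  rw [e1, integral_sub hI1 hI2, integral_halfPlane_tangential (hsm _) (hcs _) a hs,
    integral_halfPlane_normal (hsm _) (hcs _) a hs]
  ring

/-! ### The `L²` norm -/

section Norm

variable {V : Type*} [NormedAddCommGroup V] {S S' : Set Plane} {f g : Plane → V}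

lemma l2norm_nonneg : 0 ≤ l2norm S f := Real.sqrt_nonneg _

lemma l2norm_mono (h : S ⊆ S') (hf : IsL2 S' f) : l2norm S f ≤ l2norm S' f :=
  Real.sqrt_le_sqrt (setIntegral_mono_set
    ((memLp_two_iff_integrable_sq_norm hf.aestronglyMeasurable).1 hf)
    (Filter.Eventually.of_forall fun _ => sq_nonneg _) h.eventuallyLE)

lemma l2norm_congr (hS : MeasurableSet S) (h : ∀ x ∈ S, f x = g x) : l2norm S f = l2norm S g := by
  have : ∫ x in S, ‖f x‖ ^ 2 = ∫ x in S, ‖g x‖ ^ 2 :=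
    setIntegral_congr_fun hS fun x hx => by simp only [h x hx]
  rw [l2norm, l2norm, this]

lemma l2norm_eq_lpNorm (hf : IsL2 S f) :
    l2norm S f = (eLpNorm f 2 (volume.restrict S)).toReal := by
  rw [hf.eLpNorm_eq_integral_rpow_norm (by simp) (by simp), ENNReal.toReal_ofReal (by positivity),
    l2norm, Real.sqrt_eq_rpow]
  simp

lemma l2norm_add_le (hf : IsL2 S f) (hg : IsL2 S g) :
    l2norm S (fun x => f x + g x) ≤ l2norm S f + l2norm S g := by
  have h := l2norm_eq_lpNorm (hf.add hg)
  simp only [Pi.add_def] at h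
  rw [l2norm_eq_lpNorm hf, l2norm_eq_lpNorm hg, h,
    ← ENNReal.toReal_add hf.2.ne hg.2.ne]
  exact ENNReal.toReal_mono (ENNReal.add_ne_top.2 ⟨hf.2.ne, hg.2.ne⟩)
    (eLpNorm_add_le hf.1 hg.1 (by norm_num))

/-- The `L²` norm of a bounded function. -/
lemma l2norm_le_of_bound (hS : MeasurableSet S) {M A : ℝ} (hM : 0 ≤ M) (hA : 0 ≤ A)
    (hvol : volume S ≤ ENNReal.ofReal A) (h : ∀ x ∈ S, ‖f x‖ ≤ M) :
    l2norm S f ≤ M * Real.sqrt A := by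
  have hfin : volume S ≠ ⊤ := (hvol.trans_lt ENNReal.ofReal_lt_top).ne
  have : ∫ x in S, ‖f x‖ ^ 2 ≤ M ^ 2 * A := by
    calc ∫ x in S, ‖f x‖ ^ 2 ≤ ∫ _ in S, M ^ 2 := by
          refine integral_mono_of_nonneg (Filter.Eventually.of_forall fun _ => sq_nonneg _)
            (integrableOn_const hfin) ?_
          filter_upwards [ae_restrict_mem hS] with x hx
          have := h x hx
          gcongr
      _ = M ^ 2 * volume.real S := by simp [mul_comm]
      _ ≤ M ^ 2 * A := by
          gcongr
          exact ENNReal.toReal_le_of_le_ofReal hA hvol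
  rw [l2norm]
  calc Real.sqrt _ ≤ Real.sqrt (M ^ 2 * A) := Real.sqrt_le_sqrt this
    _ = M * Real.sqrt A := by rw [Real.sqrt_mul (sq_nonneg _), Real.sqrt_sq hM]

/-- The Cauchy–Schwarz inequality against a bounded factor. -/
lemma abs_setIntegral_le_l2norm (hS : MeasurableSet S) (hf : IsL2 S f) {M A : ℝ} (hM : 0 ≤ M)
    (hA : 0 ≤ A) (hvol : volume S ≤ ENNReal.ofReal A) {F : Plane → ℝ}
    (h : ∀ x ∈ S, |F x| ≤ M * ‖f x‖) :
    |∫ x in S, F x| ≤ M * Real.sqrt A * l2norm S f := by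
  have hfin : volume S < ⊤ := hvol.trans_lt ENNReal.ofReal_lt_top
  have : IsFiniteMeasure (volume.restrict S) := ⟨by simpa using hfin⟩
  have hfn : MemLp (fun x => ‖f x‖) 2 (volume.restrict S) := hf.norm
  have h1 : |∫ x in S, F x| ≤ ∫ x in S, M * ‖f x‖ := by
    refine norm_integral_le_of_norm_le (f := F) ((hfn.integrable (by norm_num)).const_mul M) ?_
    filter_upwards [ae_restrict_mem hS] with x hx using h x hx
  have h2 : ∫ x in S, ‖f x‖ ≤ Real.sqrt A * l2norm S f := by
    have := integral_mul_le_Lp_mul_Lq_of_nonneg (μ := volume.restrict S)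
      (Real.HolderConjugate.two_two) (f := fun x => ‖f x‖) (g := fun _ => (1 : ℝ))
      (Filter.Eventually.of_forall fun _ => norm_nonneg _)
      (Filter.Eventually.of_forall fun _ => zero_le_one) (by simpa using hfn) (memLp_const _)
    simp only [mul_one, Real.rpow_ofNat, one_pow, ← Real.sqrt_eq_rpow] at this
    refine this.trans ?_
    rw [mul_comm, l2norm]
    gcongr
    rw [integral_const, smul_eq_mul, mul_one, measureReal_restrict_apply_univ]
    exact ENNReal.toReal_le_of_le_ofReal hA hvol
  rw [integral_const_mul] at h1
  calc _ ≤ _ := h1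
    _ ≤ M * (Real.sqrt A * l2norm S f) := by gcongr
    _ = _ := by ring

end Norm

/-! ### Star-shaped elements near an edge -/

/-- A set that is star-shaped with respect to a ball contains the half-open segments from the ball
to the points of its closure. -/
lemma openSegment_subset_of_starConvex {U : Set Plane} {x z p : Plane} {ρ : ℝ}
    (hstar : ∀ y ∈ Metric.ball x ρ, StarConvex ℝ y U) (hz : z ∈ Metric.ball x ρ)
    (hp : p ∈ closure U) : openSegment ℝ z p ⊆ U := by
  rintro _ ⟨α, β, hα, hβ, hαβ, rfl⟩
  -- move `p` to a nearby point `p'` of `U` and compensate by moving `z` inside the ball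
  have hcont : ContinuousAt (fun p' : Plane => z + (β / α) • (p - p')) p := by fun_prop
  have hev : ∀ᶠ p' in nhds p, z + (β / α) • (p - p') ∈ Metric.ball x ρ :=
    hcont.eventually (Metric.isOpen_ball.mem_nhds (by simpa using hz))
  obtain ⟨p', hp'U, hp'⟩ := ((mem_closure_iff_frequently.1 hp).and_eventually hev).exists
  have := hstar _ hp' hp'U hα.le hβ.le hαβ
  convert this using 1
  rw [smul_add, smul_smul, mul_div_cancel₀ _ hα.ne', smul_sub]
  abel

namespace Element

variable {K : Element} {a b : Plane}

lemma IsEdge.symm (h : K.IsEdge a b) : K.IsEdge b a := by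
  obtain ⟨i, hi⟩ := h
  exact ⟨i, hi.symm⟩

lemma IsEdge.segment_subset (h : K.IsEdge a b) : segment ℝ a b ⊆ frontier K.carrier := by
  rw [K.frontier_eq]
  obtain ⟨i, ⟨rfl, rfl⟩ | ⟨rfl, rfl⟩⟩ := h
  · exact subset_iUnion (fun i => segment ℝ (K.vertex i) (K.vertex (i + 1))) i
  · rw [segment_symm]
    exact subset_iUnion (fun i => segment ℝ (K.vertex i) (K.vertex (i + 1))) i

lemma notMem_of_mem_frontier {x : Plane} (h : x ∈ frontier K.carrier) : x ∉ K.carrier :=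
  fun hx => (disjoint_left.1 (disjoint_frontier_iff_isOpen.2 K.isOpen)) h hx

lemma dist_le_diam {x y : Plane} (hx : x ∈ closure K.carrier) (hy : y ∈ closure K.carrier) :
    dist x y ≤ K.diam := by
  rw [diam, ← Metric.diam_closure]
  exact Metric.dist_le_diam_of_mem K.isBounded.closure hx hy

lemma IsEdge.dist_le (h : K.IsEdge a b) : dist a b ≤ K.diam :=
  dist_le_diam (frontier_subset_closure (h.segment_subset (left_mem_segment ℝ a b)))
    (frontier_subset_closure (h.segment_subset (right_mem_segment ℝ a b)))

/-- A box of relative width `1/2` and relative height `c²/16` attached to the middle of the edge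
`ab`, on the left of the edge oriented from `a` to `b`, lies in `K`. Here `c` is the regularity
constant, and `c²/16` is small enough for the box to stay inside the triangle over the edge whose
apex is the centre of the ball. -/
def HasLeftBox (K : Element) (c : ℝ) (a b : Plane) : Prop :=
  ∀ t ∈ Icc (1 / 4 : ℝ) (3 / 4), ∀ r ∈ Ioc (0 : ℝ) (c ^ 2 / 16),
    a + t • (b - a) + r • rot90 (b - a) ∈ K.carrier

end Element

lemma inner_rot90_self (w : Plane) : ⟪w, rot90 w⟫ = 0 := by rw [inner_rot90]; ring

/-- Expansion of `x` in the orthogonal vectors `w` and `rot90 w`. -/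
lemma eq_add_smul_rot90 (a x : Plane) {w : Plane} (hw : ‖w‖ ≠ 0) :
    x = a + (⟪x - a, w⟫ / ‖w‖ ^ 2) • w + (⟪x - a, rot90 w⟫ / ‖w‖ ^ 2) • rot90 w := by
  have h2 : ‖w‖ ^ 2 ≠ 0 := pow_ne_zero 2 hw
  have hs := norm_sq_plane w
  ext i
  fin_cases i
  · simp [inner_plane, rot90]
    field_simp
    rw [hs]; ring
  · simp [inner_plane, rot90]
    field_simp
    rw [hs]; ring

namespace Element

variable {K : Element} {a b xB : Plane} {c : ℝ}

/-- The line through an edge misses the ball with respect to which the element is star-shaped. -/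
lemma IsEdge.le_abs_inner {ρ : ℝ} (h : K.IsEdge a b) (hab : 0 < dist a b)
    (hball : Metric.ball xB ρ ⊆ K.carrier)
    (hstar : ∀ y ∈ Metric.ball xB ρ, StarConvex ℝ y K.carrier) :
    ρ * dist a b ≤ |⟪xB - a, rot90 (b - a)⟫| := by
  by_contra! hlt
  set w := b - a with hw
  have hn : dist a b = ‖w‖ := by rw [dist_comm, dist_eq_norm]
  rw [hn] at hab hlt
  set d := ⟪xB - a, rot90 w⟫ with hd
  set t := ⟪xB - a, w⟫ / ‖w‖ ^ 2 with ht
  -- the projection of the centre of the ball onto the line lies in the ball, hence in `K`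
  have hz : a + t • w ∈ Metric.ball xB ρ := by
    have hx := eq_add_smul_rot90 a xB hab.ne'
    have hdist : dist (a + t • w) xB = |d| / ‖w‖ := by
      conv_lhs => rw [hx]
      rw [dist_self_add_right, norm_smul, norm_rot90, norm_div, norm_pow, norm_norm,
        Real.norm_eq_abs, ← hd]
      field_simp
    rw [Metric.mem_ball, hdist, div_lt_iff₀ hab]
    exact hlt
  have ha := h.segment_subset (left_mem_segment ℝ a b)
  have hb := h.segment_subset (right_mem_segment ℝ a b)
  -- if it is beyond an endpoint, this endpoint is between it and the other one, hence in `K`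
  rcases lt_or_ge t 0 with h0 | h0
  · refine notMem_of_mem_frontier ha (openSegment_subset_of_starConvex hstar hz
      (frontier_subset_closure hb) ⟨1 / (1 - t), -t / (1 - t), ?_, ?_, ?_, ?_⟩)
    · exact div_pos one_pos (by linarith)
    · exact div_pos (by linarith) (by linarith)
    · have : 1 - t ≠ 0 := by linarith
      field_simp; ring
    · have h1 : 1 - t ≠ 0 := by linarith
      ext i
      simp [hw]
      field_simp; ring
  rcases le_or_gt t 1 with h1 | h1
  · refine notMem_of_mem_frontier (h.segment_subset ?_) (hball hz)
    rw [segment_eq_image']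
    exact ⟨t, ⟨h0, h1⟩, rfl⟩
  · refine notMem_of_mem_frontier hb (openSegment_subset_of_starConvex hstar hz
      (frontier_subset_closure ha) ⟨1 / t, (t - 1) / t, ?_, ?_, ?_, ?_⟩)
    · exact div_pos one_pos (by linarith)
    · exact div_pos (by linarith) (by linarith)
    · have : t ≠ 0 := by linarith
      field_simp; ring
    · have h1 : t ≠ 0 := by linarith
      ext i
      simp [hw]
      field_simp; ring

/-- A box attached to the edge lies in the element if the centre of the ball is on the left. -/
lemma IsEdge.hasLeftBox (h : K.IsEdge a b) (hc : 0 < c) (hlen : c * K.diam < dist a b)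
    (hball : Metric.ball xB (c * K.diam) ⊆ K.carrier)
    (hstar : ∀ y ∈ Metric.ball xB (c * K.diam), StarConvex ℝ y K.carrier)
    (hside : 0 < ⟪xB - a, rot90 (b - a)⟫) : K.HasLeftBox c a b := by
  have hdiam0 : 0 ≤ K.diam := Metric.diam_nonneg
  have hab : 0 < dist a b := lt_of_le_of_lt (by positivity) hlen
  have hle := h.dist_le
  have hdiam : 0 < K.diam := hab.trans_le hle
  have hc1 : c < 1 := by nlinarith
  have hxB : xB ∈ Metric.ball xB (c * K.diam) := Metric.mem_ball_self (by positivity)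
  have hd := h.le_abs_inner hab hball hstar
  rw [abs_of_pos hside] at hd
  have hxa : ‖xB - a‖ ≤ K.diam := by
    rw [← dist_eq_norm]
    exact dist_le_diam (subset_closure (hball hxB))
      (frontier_subset_closure (h.segment_subset (left_mem_segment ℝ a b)))
  set w := b - a with hw
  have hn : dist a b = ‖w‖ := by rw [dist_comm, dist_eq_norm]
  rw [hn] at hab hle hlen hd
  have hx := eq_add_smul_rot90 a xB hab.ne'
  set tB := ⟪xB - a, w⟫ / ‖w‖ ^ 2 with htB
  set rB := ⟪xB - a, rot90 w⟫ / ‖w‖ ^ 2 with hrB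
  -- in coordinates relative to the edge, the centre `(tB, rB)` is neither low nor far away
  have hrc : c ≤ rB := by
    rw [hrB, le_div_iff₀ (by positivity)]
    calc c * ‖w‖ ^ 2 = c * ‖w‖ * ‖w‖ := by ring
      _ ≤ c * K.diam * ‖w‖ := by gcongr
      _ ≤ _ := hd
  have htc : |tB| * c ≤ 1 := by
    rw [htB, abs_div, abs_of_pos (pow_pos hab 2), div_mul_eq_mul_div, div_le_one (by positivity)]
    calc |⟪xB - a, w⟫| * c ≤ (‖xB - a‖ * ‖w‖) * c := by
          gcongr; exact abs_real_inner_le_norm _ _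
      _ ≤ (K.diam * ‖w‖) * c := by gcongr
      _ = c * K.diam * ‖w‖ := by ring
      _ ≤ ‖w‖ * ‖w‖ := by gcongr
      _ = ‖w‖ ^ 2 := by ring
  rintro t ⟨ht1, ht2⟩ r ⟨hr1, hr2⟩
  -- the point `(t, r)` is a convex combination, with weight `τ = r / rB`, of the centre and of a
  -- point `(t', 0)` of the edge
  have hrB0 : 0 < rB := hc.trans_le hrc
  set τ := r / rB with hτ
  have hτ0 : 0 < τ := div_pos hr1 hrB0
  have hτc : τ ≤ c / 16 := by
    rw [hτ, div_le_iff₀ hrB0]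
    nlinarith
  have hτt : |τ * tB| ≤ 1 / 16 := by
    rw [abs_mul, abs_of_pos hτ0]
    nlinarith [abs_nonneg tB]
  obtain ⟨hτt1, hτt2⟩ := abs_le.1 hτt
  have hτ1 : 0 < 1 - τ := by linarith
  set t' := (t - τ * tB) / (1 - τ) with ht'
  have hmem : a + t' • w ∈ segment ℝ a b := by
    rw [segment_eq_image']
    refine ⟨t', ⟨div_nonneg (by linarith) hτ1.le, ?_⟩, rfl⟩
    rw [ht', div_le_one hτ1]
    linarith
  refine openSegment_subset_of_starConvex hstar hxB
    (frontier_subset_closure (h.segment_subset hmem)) ⟨τ, 1 - τ, hτ0, hτ1, by ring, ?_⟩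
  have e1 : τ * rB = r := div_mul_cancel₀ _ hrB0.ne'
  have e2 : (1 - τ) * t' = t - τ * tB := mul_div_cancel₀ _ hτ1.ne'
  rw [hx, ← e1, show t = (1 - τ) * t' + τ * tB by rw [e2]; ring]
  module

end Element

section Mesh

variable {Ω : Set Plane} {T : Mesh Ω} {c : ℝ} {i j : Fin T.m} {a b : Plane}

lemma Mesh.IsRegular.dist_pos (hT : T.IsRegular c) (hc : 0 < c) (h : (T.elem i).IsEdge a b) :
    0 < dist a b :=
  lt_of_le_of_lt (mul_nonneg hc.le Metric.diam_nonneg) ((hT i).1 a b h)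

lemma Mesh.IsRegular.diam_pos (hT : T.IsRegular c) (hc : 0 < c) (i : Fin T.m) :
    0 < (T.elem i).diam := by
  have h : (T.elem i).IsEdge ((T.elem i).vertex 0) ((T.elem i).vertex (0 + 1)) :=
    ⟨0, Or.inl ⟨rfl, rfl⟩⟩
  exact (hT.dist_pos hc h).trans_le h.dist_le

/-- Every element lies on one side of each of its edges. -/
lemma Mesh.IsRegular.hasLeftBox_or (hT : T.IsRegular c) (hc : 0 < c)
    (h : (T.elem i).IsEdge a b) :
    (T.elem i).HasLeftBox c a b ∨ (T.elem i).HasLeftBox c b a := by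
  obtain ⟨hlen, xB, hball, hstar⟩ := hT i
  have hab := hT.dist_pos hc h
  have h1 := h.le_abs_inner hab hball hstar
  have h2 : 0 < |⟪xB - a, rot90 (b - a)⟫| :=
    lt_of_lt_of_le (mul_pos (mul_pos hc (hT.diam_pos hc i)) hab) h1
  rcases lt_or_gt_of_ne (abs_pos.1 h2) with h3 | h3
  · refine Or.inr (h.symm.hasLeftBox hc (hlen _ _ h.symm) hball hstar ?_)
    rw [inner_rot90] at h3 ⊢
    simp at h3 ⊢
    linarith
  · exact Or.inl (h.hasLeftBox hc (hlen _ _ h) hball hstar h3)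

/-- Two different elements are not on the same side of a common edge. -/
lemma Mesh.eq_of_hasLeftBox (hc : 0 < c) (hi : (T.elem i).HasLeftBox c a b)
    (hj : (T.elem j).HasLeftBox c a b) : i = j := by
  by_contra hij
  have ht : (1 / 2 : ℝ) ∈ Icc (1 / 4 : ℝ) (3 / 4) := by norm_num
  have hr : c ^ 2 / 16 ∈ Ioc (0 : ℝ) (c ^ 2 / 16) := ⟨by positivity, le_rfl⟩
  exact disjoint_left.1 (T.disjoint hij) (hi _ ht _ hr) (hj _ ht _ hr)

/-- The two elements sharing an edge lie on opposite sides of it. -/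
lemma Mesh.IsRegular.hasLeftBox_and_or (hT : T.IsRegular c) (hc : 0 < c)
    (h : T.IsInteriorEdge i j a b) :
    (T.elem i).HasLeftBox c a b ∧ (T.elem j).HasLeftBox c b a ∨
      (T.elem j).HasLeftBox c a b ∧ (T.elem i).HasLeftBox c b a := by
  obtain ⟨hij, hi, hj, -⟩ := h
  rcases hT.hasLeftBox_or hc hi with h1 | h1 <;> rcases hT.hasLeftBox_or hc hj with h2 | h2
  · exact absurd (T.eq_of_hasLeftBox hc h1 h2) hij
  · exact Or.inl ⟨h1, h2⟩
  · exact Or.inr ⟨h2, h1⟩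
  · exact absurd (T.eq_of_hasLeftBox hc h1 h2) hij

/-- An edge is shared by at most two elements. -/
lemma Mesh.IsRegular.eq_of_isInteriorEdge {j' : Fin T.m} (hT : T.IsRegular c) (hc : 0 < c)
    (h : T.IsInteriorEdge i j a b) (h' : T.IsInteriorEdge i j' a b) : j = j' := by
  rcases hT.hasLeftBox_and_or hc h with ⟨h1, h2⟩ | ⟨h1, h2⟩ <;>
    rcases hT.hasLeftBox_and_or hc h' with ⟨h3, h4⟩ | ⟨h3, h4⟩
  · exact T.eq_of_hasLeftBox hc h2 h4
  · exact absurd (T.eq_of_hasLeftBox hc h1 h3) h'.1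
  · exact absurd (T.eq_of_hasLeftBox hc h3 h1) h.1
  · exact T.eq_of_hasLeftBox hc h1 h3

lemma Mesh.glue_of_mem {V : Type*} [AddCommMonoid V] (F : Fin T.m → Plane → V) {x : Plane}
    (hx : x ∈ (T.elem i).carrier) : T.glue F x = F i x := by
  rw [Mesh.glue, Finset.sum_eq_single i, indicator_of_mem hx]
  · intro j _ hj
    exact indicator_of_notMem (fun h => disjoint_left.1 (T.disjoint hj) h hx) _
  · simp

end Mesh

/-! ### Degrees and square integrable fields -/

lemma totalDegree_pderiv_le (i : Fin 2) (p : MvPolynomial (Fin 2) ℝ) :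
    (MvPolynomial.pderiv i p).totalDegree ≤ p.totalDegree := by
  conv_lhs => rw [p.as_sum, map_sum]
  refine MvPolynomial.totalDegree_finsetSum_le fun d hd => ?_
  rw [MvPolynomial.pderiv_monomial]
  refine (MvPolynomial.totalDegree_monomial_le _ _).trans ?_
  refine le_trans ?_ (MvPolynomial.le_totalDegree hd)
  exact Finsupp.degree_mono (show d - Finsupp.single i 1 ≤ d from tsub_le_self)

lemma IsP.totalDegree_le {k : ℕ} {p : MvPolynomial (Fin 2) ℝ} (h : IsP k p) :
    p.totalDegree ≤ k := by
  rcases h with rfl | h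
  · simp
  · exact_mod_cast h

lemma totalDegree_polyRot_le {k : ℕ} {q : PolyField} (h : IsPField k q) :
    (polyRot q).totalDegree ≤ k :=
  (MvPolynomial.totalDegree_sub _ _).trans (max_le
    ((totalDegree_pderiv_le _ _).trans (h 1).totalDegree_le)
    ((totalDegree_pderiv_le _ _).trans (h 0).totalDegree_le))

lemma IsL2.mono {V : Type*} [NormedAddCommGroup V] {S S' : Set Plane} {f : Plane → V}
    (h : IsL2 S' f) (hS : S ⊆ S') : IsL2 S f :=
  h.mono_measure (Measure.restrict_mono hS le_rfl)

lemma isL2_of_continuous {V : Type*} [NormedAddCommGroup V] {S : Set Plane} {f : Plane → V}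
    (hf : Continuous f) (hS : Bornology.IsBounded S) : IsL2 S f := by
  have h1 : IsL2 (closure S) f := by
    have hK := hS.isCompact_closure
    have : IsFiniteMeasure (volume.restrict (closure S)) := ⟨by simpa using hK.measure_lt_top⟩
    obtain ⟨C, hC⟩ := hK.exists_bound_of_continuousOn hf.continuousOn
    refine MemLp.of_bound (hf.continuousOn.aestronglyMeasurable_of_isCompact hK
      hK.measurableSet) C ?_
    filter_upwards [ae_restrict_mem hK.measurableSet] with x hx using hC x hx
  exact h1.mono subset_closure

lemma IsL2.integrable_inner {S : Set Plane} {f g : Plane → Plane} (hf : IsL2 S f)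
    (hg : IsL2 S g) : Integrable (fun x => ⟪f x, g x⟫) (volume.restrict S) := by
  refine (hf.norm.integrable_mul hg.norm).mono (hf.1.inner hg.1)
    (Filter.Eventually.of_forall fun x => ?_)
  simpa using abs_real_inner_le_norm (f x) (g x)

lemma norm_curl_le {φ : Plane → ℝ} {x : Plane} {M : ℝ} (h : ∀ i, |pd i φ x| ≤ M) :
    ‖curl φ x‖ ≤ 2 * M := by
  have hM : 0 ≤ M := (abs_nonneg _).trans (h 0)
  refine abs_le_of_sq_le_sq' ?_ (by positivity) |>.2
  rw [norm_sq_plane]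
  have h0 := sq_le_sq' (abs_le.1 (h 0)).1 (abs_le.1 (h 0)).2
  have h1 := sq_le_sq' (abs_le.1 (h 1)).1 (abs_le.1 (h 1)).2
  simp [curl]
  nlinarith

lemma volume_le_of_subset_closedBall {S : Set Plane} {x : Plane} {h : ℝ}
    (hS : S ⊆ Metric.closedBall x h) (hh : 0 ≤ h) :
    volume S ≤ ENNReal.ofReal (h ^ 2 * Real.pi) := by
  refine (measure_mono hS).trans ?_
  rw [EuclideanSpace.volume_closedBall_fin_two, ENNReal.ofReal_mul (by positivity),
    ENNReal.ofReal_pow hh]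

lemma sqrt_sq_mul_pi {h : ℝ} (hh : 0 ≤ h) :
    Real.sqrt (h ^ 2 * Real.pi) = h * Real.sqrt Real.pi := by
  rw [Real.sqrt_mul (sq_nonneg _), Real.sqrt_sq hh]

/-- A test function supported in a subset `S` of `Ω` sees only `S`. -/
lemma integral_inner_curl_eq {S Ω : Set Plane} (hS : S ⊆ Ω) (hΩ : MeasurableSet Ω)
    (ζ : Plane → Plane) {φ : Plane → ℝ} (h : ∀ x ∈ Ω, x ∉ S → x ∉ tsupport φ) :
    ∫ x in Ω, ⟪ζ x, curl φ x⟫ = ∫ x in S, ⟪ζ x, curl φ x⟫ :=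
  setIntegral_eq_of_subset_of_forall_sdiff_eq_zero hΩ hS fun x hx => by
    rw [curl_eq_zero_of_notMem (h x hx.1 hx.2), inner_zero_right]

lemma HasWeakRot.integral_eq_zero {Ω : Set Plane} {ζ : Plane → Plane} (h : HasWeakRot Ω ζ 0)
    {φ : Plane → ℝ} (hφ : IsTest Ω φ) : ∫ x in Ω, ⟪ζ x, curl φ x⟫ = 0 := by
  rw [h.weak φ hφ]; simp

/-! ### The element residual -/

/-- From `A² = C I` and a bound of `I` that is linear in `A`, a bound of `A`. -/
lemma le_of_sq_le_mul {A B : ℝ} (hB : 0 ≤ B) (h : A ^ 2 ≤ B * A) : A ≤ B := by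
  by_contra! hlt
  nlinarith

/-- The element residual `rot ζ_h` is bounded by the error: test with the residual times a bump
function on the ball with respect to which the element is star-shaped. -/
theorem exists_rot_bound (c : ℝ) (hc : 0 < c) (k : ℕ) : ∃ C : ℝ, 0 < C ∧
    ∀ (Ω : Set Plane) (T : Mesh Ω), IsOpen Ω → T.IsRegular c →
    ∀ (q : PolyField) (ζ : Plane → Plane), IsPField k q → HasWeakRot Ω ζ 0 →
    ∀ i, (T.elem i).diam * l2norm (T.elem i).carrier (polyFun (polyRot q)) ≤
      C * l2norm (T.elem i).carrier (fun x => ζ x - polyField q x) := by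
  let b : ContDiffBump (0 : Plane) := ⟨c / 4, c / 2, by positivity, by linarith⟩
  have hbs : ContDiff ℝ ∞ b := b.contDiff
  obtain ⟨C₁, hC₁, hnorm⟩ := exists_polyFun_sq_le_scaled k b b.continuous b.hasCompactSupport
    (fun x => b.nonneg) (b.pos_of_mem_ball (Metric.mem_ball_self b.rOut_pos))
  obtain ⟨D, hD⟩ := (hasCompactSupport_curl b.hasCompactSupport).exists_bound_of_continuous
    (continuous_curl hbs)
  have hD0 : 0 ≤ D := (norm_nonneg _).trans (hD 0)
  have hpdb : ∀ i y, |pd i b y| ≤ D := by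
    intro i y
    refine le_trans ?_ (hD y)
    refine abs_le_of_sq_le_sq ?_ (norm_nonneg _)
    rw [norm_sq_plane]
    fin_cases i <;> simp [curl] <;> positivity
  set R := Real.sqrt Real.pi with hR
  refine ⟨R * (C₁ * (2 * (1 + D) * R)) + 1, by positivity, ?_⟩
  intro Ω T hΩ hT q ζ hq hζ i
  set K := T.elem i with hK
  obtain ⟨-, x₀, hball, -⟩ := hT i
  set h := K.diam with hh
  have hh0 : 0 < h := hT.diam_pos hc i
  have hx₀ : x₀ ∈ K.carrier := hball (Metric.mem_ball_self (by positivity))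
  have hKball : K.carrier ⊆ Metric.closedBall x₀ h := fun x hx =>
    Element.dist_le_diam (subset_closure hx) (subset_closure hx₀)
  have hKm : MeasurableSet K.carrier := K.isOpen.measurableSet
  have hvol := volume_le_of_subset_closedBall hKball hh0.le
  set p := polyRot q with hp
  have hpk : p.totalDegree ≤ k := totalDegree_polyRot_le hq
  set φ : Plane → ℝ := fun x => b (h⁻¹ • (x - x₀)) * polyFun p x with hφ
  have hbcomp : ContDiff ℝ ∞ fun x : Plane => b (h⁻¹ • (x - x₀)) := hbs.comp (by fun_prop)
  have hφs : ContDiff ℝ ∞ φ := hbcomp.mul (contDiff_polyFun p)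
  have hsupp : tsupport φ ⊆ Metric.closedBall x₀ (h * (c / 2)) := by
    refine closure_minimal (fun x hx => ?_) Metric.isClosed_closedBall
    have h1 : h⁻¹ • (x - x₀) ∈ Function.support b := left_ne_zero_of_mul hx
    rw [b.support_eq, mem_ball_zero_iff, norm_smul, norm_inv, Real.norm_of_nonneg hh0.le,
      inv_mul_lt_iff₀ hh0] at h1
    rw [Metric.mem_closedBall, dist_eq_norm]
    exact h1.le
  have hsK : tsupport φ ⊆ K.carrier := hsupp.trans
    ((Metric.closedBall_subset_ball (by nlinarith)).trans hball)
  have hcs : HasCompactSupport φ :=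
    (isCompact_closedBall x₀ (h * (c / 2))).of_isClosed_subset (isClosed_tsupport φ) hsupp
  set I := ∫ z, b (h⁻¹ • (z - x₀)) * polyFun p z ^ 2 with hI
  have hI0 : 0 ≤ I := integral_nonneg fun z => mul_nonneg b.nonneg (sq_nonneg _)
  set A := Real.sqrt (C₁ * I) with hA
  have hA0 : 0 ≤ A := Real.sqrt_nonneg _
  have hA2 : A ^ 2 = C₁ * I := Real.sq_sqrt (by positivity)
  -- pointwise bounds of the residual and its gradient
  have hp0 : ∀ x ∈ K.carrier, |polyFun p x| ≤ A / h := by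
    intro x hx
    have := (hnorm p hpk x₀ h hh0 x (hKball hx)).1
    refine abs_le_of_sq_le_sq ?_ (by positivity)
    rw [div_pow, le_div_iff₀ (by positivity), hA2]
    linarith
  have hp1 : ∀ x ∈ K.carrier, ∀ j, |polyFun (MvPolynomial.pderiv j p) x| ≤ A / h ^ 2 := by
    intro x hx j
    have := (hnorm p hpk x₀ h hh0 x (hKball hx)).2 j
    refine abs_le_of_sq_le_sq ?_ (by positivity)
    rw [div_pow, le_div_iff₀ (by positivity), hA2]
    linarith
  have hpdcomp : ∀ j x, pd j (fun x : Plane => b (h⁻¹ • (x - x₀))) x =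
      h⁻¹ * pd j b (h⁻¹ • (x - x₀)) := by
    intro j x
    have h1 : HasFDerivAt (fun x : Plane => h⁻¹ • (x - x₀))
        (h⁻¹ • ContinuousLinearMap.id ℝ Plane) x := ((hasFDerivAt_id x).sub_const x₀).const_smul h⁻¹
    have h2 := (hbs.differentiable (by simp) (h⁻¹ • (x - x₀))).hasFDerivAt.comp x h1
    rw [pd, pd]
    erw [h2.fderiv]
    simp only [ContinuousLinearMap.comp_apply, _root_.smul_apply, map_smul,
      smul_eq_mul, ContinuousLinearMap.id_apply]
  have hcurl : ∀ x ∈ K.carrier, ‖curl φ x‖ ≤ 2 * ((1 + D) * (A / h ^ 2)) := by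
    intro x hx
    refine norm_curl_le fun j => ?_
    rw [pd_mul (hbcomp.differentiable (by simp) x) ((contDiff_polyFun p).differentiable (by simp) x),
      pd_polyFun, hpdcomp]
    calc _ ≤ |b (h⁻¹ • (x - x₀)) * polyFun (MvPolynomial.pderiv j p) x| +
          |h⁻¹ * pd j b (h⁻¹ • (x - x₀)) * polyFun p x| := abs_add_le _ _
      _ ≤ 1 * (A / h ^ 2) + h⁻¹ * D * (A / h) := by
          rw [abs_mul, abs_mul, abs_mul, abs_of_nonneg b.nonneg, abs_of_pos (inv_pos.2 hh0)]
          gcongr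
          · exact b.le_one
          · exact hp1 x hx j
          · exact hpdb _ _
          · exact hp0 x hx
      _ = (1 + D) * (A / h ^ 2) := by field_simp
  set E := l2norm K.carrier (fun x => ζ x - polyField q x) with hE
  have hE0 : 0 ≤ E := l2norm_nonneg
  have hζK : IsL2 K.carrier ζ := hζ.isL2.mono (T.subset i)
  have hqK : IsL2 K.carrier (polyField q) := isL2_of_continuous (continuous_polyField q) K.isBounded
  have hcK : IsL2 K.carrier (curl φ) := isL2_of_continuous (continuous_curl hφs) K.isBounded
  -- Green's formula, where the boundary terms vanish because of the bump
  have hIeq : -I = ∫ x in K.carrier, ⟪ζ x - polyField q x, curl φ x⟫ := by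
    simp only [inner_sub_left]
    rw [integral_sub (hζK.integrable_inner hcK) (hqK.integrable_inner hcK),
      ← integral_inner_curl_eq (T.subset i) hΩ.measurableSet ζ (fun x _ hx hx' => hx (hsK hx')),
      hζ.integral_eq_zero ⟨hφs, hcs, hsK.trans (T.subset i)⟩,
      ← integral_inner_curl_eq (subset_univ _) MeasurableSet.univ _
        (fun x _ hx hx' => hx (hsK hx')), Measure.restrict_univ,
      integral_inner_curl q hφs hcs, zero_sub, hI, neg_inj]
    refine integral_congr_ae (Filter.Eventually.of_forall fun x => ?_)
    simp only [hφ]; ring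
  have hIle : I ≤ 2 * ((1 + D) * (A / h ^ 2)) * (h * R) * E := by
    have := abs_setIntegral_le_l2norm hKm (hζK.sub hqK)
      (M := 2 * ((1 + D) * (A / h ^ 2))) (by positivity) (by positivity) hvol
      (F := fun x => ⟪ζ x - polyField q x, curl φ x⟫) (fun x hx => by
        refine (abs_real_inner_le_norm _ _).trans ?_
        rw [mul_comm]
        exact mul_le_mul_of_nonneg_right (hcurl x hx) (norm_nonneg _))
    rw [← hIeq, abs_neg, abs_of_nonneg hI0, sqrt_sq_mul_pi hh0.le] at this
    exact this
  have hAle : A ≤ C₁ * (2 * (1 + D) * R) * E / h := by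
    refine le_of_sq_le_mul (by positivity) ?_
    rw [hA2]
    calc C₁ * I ≤ C₁ * (2 * ((1 + D) * (A / h ^ 2)) * (h * R) * E) := by gcongr
      _ = _ := by field_simp
  have hl2 : l2norm K.carrier (polyFun p) ≤ A / h * (h * R) := by
    have := l2norm_le_of_bound (f := polyFun p) hKm (by positivity) (by positivity) hvol hp0
    rwa [sqrt_sq_mul_pi hh0.le] at this
  calc h * l2norm K.carrier (polyFun p) ≤ h * (A / h * (h * R)) := by gcongr
    _ = h * R * A := by field_simp
    _ ≤ h * R * (C₁ * (2 * (1 + D) * R) * E / h) := by gcongr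
    _ = R * (C₁ * (2 * (1 + D) * R)) * E := by field_simp
    _ ≤ (R * (C₁ * (2 * (1 + D) * R)) + 1) * E := by nlinarith

/-! ### The jump residual -/

lemma volume_line_eq_zero (a : Plane) {s : Plane} (hs : ‖s‖ = 1) :
    volume {x : Plane | ⟪x - a, rot90 s⟫ = 0} = 0 := by
  obtain ⟨h1, h2⟩ := measurePreserving_frame a hs
  have hs2 : s 0 * s 0 + s 1 * s 1 = 1 := by
    have := norm_sq_plane s; rw [hs] at this; linarith
  have hpre : (fun p : ℝ × ℝ => a + p.1 • s + p.2 • rot90 s) ⁻¹' {x | ⟪x - a, rot90 s⟫ = 0} =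
      univ ×ˢ {0} := by
    ext p
    have : ⟪a + p.1 • s + p.2 • rot90 s - a, rot90 s⟫ = p.2 := by
      rw [inner_rot90]; simp [rot90]; linear_combination p.2 * hs2
    simp [this]
  rw [← h1.measure_preimage_emb h2, hpre, Measure.volume_eq_prod, Measure.prod_prod]
  simp

lemma rot90_neg (s : Plane) : rot90 (-s) = -rot90 s := by
  ext i; fin_cases i <;> simp [rot90]

/-- The tangential jump across a line, tested with `φ`, in terms of the element residuals and of
the error on both sides of the line. -/
lemma integral_jump_eq {Ω : Set Plane} (hΩ : IsOpen Ω) {ζ : Plane → Plane}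
    (hζ : HasWeakRot Ω ζ 0) {φ : Plane → ℝ} (hφ : IsTest Ω φ) (a : Plane) {s : Plane}
    (hs : ‖s‖ = 1) (q q' : PolyField) :
    ∫ u : ℝ, φ (a + u • s) * ⟪polyField q (a + u • s) - polyField q' (a + u • s), s⟫ =
      (∫ x in tsupport φ ∩ halfPlane a s, polyFun (polyRot q) x * φ x) +
      (∫ x in tsupport φ ∩ halfPlane a (-s), polyFun (polyRot q') x * φ x) +
      (∫ x in tsupport φ ∩ halfPlane a s, ⟪ζ x - polyField q x, curl φ x⟫) +
      (∫ x in tsupport φ ∩ halfPlane a (-s), ⟪ζ x - polyField q' x, curl φ x⟫) := by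
  have hφs := hφ.1
  have hcs := hφ.2.1
  have hbdd : Bornology.IsBounded (tsupport φ) := hcs.isCompact.isBounded
  have hns : ‖-s‖ = 1 := by rw [norm_neg, hs]
  have hE := isClosedEmbedding_line a hs
  -- restriction of the half-plane integrals to the support of the test function
  have hrot : ∀ (p : MvPolynomial (Fin 2) ℝ) (s : Plane),
      ∫ x in tsupport φ ∩ halfPlane a s, polyFun p x * φ x =
        ∫ x in halfPlane a s, polyFun p x * φ x := fun p s =>
    (setIntegral_eq_of_subset_of_forall_sdiff_eq_zero (measurableSet_halfPlane a s)
      inter_subset_right fun x hx => by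
        rw [image_eq_zero_of_notMem_tsupport fun h => hx.2 ⟨h, hx.1⟩, mul_zero]).symm
  have hL2c : ∀ U ⊆ tsupport φ, IsL2 U (curl φ) := fun U hU =>
    isL2_of_continuous (continuous_curl hφs) (hbdd.subset hU)
  have hsplit : ∀ (p : PolyField) (s : Plane),
      ∫ x in tsupport φ ∩ halfPlane a s, ⟪ζ x - polyField p x, curl φ x⟫ =
        (∫ x in tsupport φ ∩ halfPlane a s, ⟪ζ x, curl φ x⟫) -
          ∫ x in halfPlane a s, ⟪polyField p x, curl φ x⟫ := by
    intro p s
    simp only [inner_sub_left]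
    have hU : tsupport φ ∩ halfPlane a s ⊆ tsupport φ := inter_subset_left
    rw [integral_sub ((hζ.isL2.mono (hU.trans hφ.2.2)).integrable_inner (hL2c _ hU))
      ((isL2_of_continuous (continuous_polyField p) (hbdd.subset hU)).integrable_inner
        (hL2c _ hU)),
      ← integral_inner_curl_eq inter_subset_right (measurableSet_halfPlane a s) (polyField p)
        fun x hx hx' h => hx' ⟨h, hx⟩]
  have hzero : (∫ x in tsupport φ ∩ halfPlane a s, ⟪ζ x, curl φ x⟫) +
      ∫ x in tsupport φ ∩ halfPlane a (-s), ⟪ζ x, curl φ x⟫ = 0 := by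
    have hm := hcs.isCompact.measurableSet
    have hae : (tsupport φ \ halfPlane a s : Set Plane) =ᵐ[volume]
        (tsupport φ ∩ halfPlane a (-s) : Set Plane) := by
      have hnull : ∀ᵐ x : Plane, ⟪x - a, rot90 s⟫ ≠ 0 := by
        rw [ae_iff]
        simpa using volume_line_eq_zero a hs
      filter_upwards [hnull] with x hx
      refine propext (and_congr_right fun _ => ?_)
      simp only [halfPlane, Set.mem_ofPred_eq, rot90_neg, inner_neg_right]
      constructor
      · intro h
        have h' : ¬ 0 < ⟪x - a, rot90 s⟫ := h
        change 0 < -⟪x - a, rot90 s⟫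
        have := lt_of_le_of_ne (not_lt.1 h') hx
        linarith
      · intro h h'
        change 0 < -⟪x - a, rot90 s⟫ at h
        change 0 < ⟪x - a, rot90 s⟫ at h'
        linarith
    rw [← setIntegral_congr_set hae, integral_inter_add_sdiff (measurableSet_halfPlane a s)
      ((hζ.isL2.mono hφ.2.2).integrable_inner (hL2c _ subset_rfl)),
      ← integral_inner_curl_eq hφ.2.2 hΩ.measurableSet ζ (fun _ _ h => h),
      hζ.integral_eq_zero hφ]
  have hneg : ∫ u : ℝ, φ (a + u • -s) * ⟪polyField q' (a + u • -s), -s⟫ =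
      -∫ u : ℝ, φ (a + u • s) * ⟪polyField q' (a + u • s), s⟫ := by
    rw [← integral_neg_eq_self, ← integral_neg]
    simp
  have hint : ∀ p : PolyField,
      Integrable fun u : ℝ => φ (a + u • s) * ⟪polyField p (a + u • s), s⟫ := fun p =>
    ((hφs.continuous.comp hE.continuous).mul (((continuous_polyField p).comp
      hE.continuous).inner continuous_const)).integrable_of_hasCompactSupport
        (hcs.comp_isClosedEmbedding hE).mul_right
  rw [hrot, hrot, hsplit, hsplit, integral_halfPlane_inner_curl q hφs hcs a hs,
    integral_halfPlane_inner_curl q' hφs hcs a hns, hneg]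
  simp only [inner_sub_left, mul_sub]
  rw [integral_sub (hint q) (hint q')]
  linarith

lemma pd_comp_coord {Ψ : ℝ → ℝ} (hΨ : Differentiable ℝ Ψ) (a v : Plane) (H : ℝ) (i : Fin 2)
    (x : Plane) : pd i (fun y => Ψ (⟪y - a, v⟫ / H)) x = deriv Ψ (⟪x - a, v⟫ / H) * (v i / H) := by
  have h1 : HasFDerivAt (fun y : Plane => ⟪y - a, v⟫ / H) (H⁻¹ • innerSL ℝ v) x := by
    have h2 := ((innerSL ℝ v).hasFDerivAt (x := x - a)).comp x ((hasFDerivAt_id x).sub_const a)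
    have h3 := h2.const_smul H⁻¹
    convert! h3 using 1
    ext y
    simp [real_inner_comm, div_eq_inv_mul]
  have h5 : HasFDerivAt (fun y => Ψ (⟪y - a, v⟫ / H))
      (deriv Ψ (⟪x - a, v⟫ / H) • H⁻¹ • innerSL ℝ v) x :=
    (hΨ _).hasDerivAt.comp_hasFDerivAt x h1
  rw [pd, h5.fderiv]
  have h4 : ⟪v, EuclideanSpace.single i (1 : ℝ)⟫ = v i := by
    rw [inner_plane]; fin_cases i <;> simp
  simp [h4, div_eq_inv_mul]

lemma abs_coord_le (v : Plane) (i : Fin 2) : |v i| ≤ ‖v‖ := by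
  simpa using PiLp.norm_apply_le v i

lemma norm_tangent {a b : Plane} (h : 0 < dist a b) : ‖tangent a b‖ = 1 := by
  rw [tangent, norm_smul, norm_inv, Real.norm_of_nonneg dist_nonneg, ← dist_eq_norm, dist_comm b,
    inv_mul_cancel₀ h.ne']

/-- The box of relative size `1/2 × 2δ` around the middle of the segment `ab`. -/
def edgeBox (a b : Plane) (δ : ℝ) : Set Plane :=
  {x | ⟪x - a, b - a⟫ / ‖b - a‖ ^ 2 ∈ Icc (1 / 4 : ℝ) (3 / 4) ∧
    ⟪x - a, rot90 (b - a)⟫ / ‖b - a‖ ^ 2 ∈ Icc (-δ) δ}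

lemma isClosed_edgeBox (a b : Plane) (δ : ℝ) : IsClosed (edgeBox a b δ) := by
  refine IsClosed.inter (isClosed_Icc.preimage ?_) (isClosed_Icc.preimage ?_) <;> fun_prop

section EdgeBox

variable {a b : Plane} {δ : ℝ}

lemma edgeBox_subset_closedBall (hab : 0 < dist a b) (hδ : δ ≤ 1 / 16) :
    edgeBox a b δ ⊆ Metric.closedBall a (dist a b) := by
  intro x hx
  have hn : dist a b = ‖b - a‖ := by rw [dist_comm, dist_eq_norm]
  rw [hn] at hab ⊢
  obtain ⟨⟨h1, h2⟩, h3⟩ := hx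
  have h3' := abs_le.2 h3
  have e := eq_add_smul_rot90 a x hab.ne'
  set t := ⟪x - a, b - a⟫ / ‖b - a‖ ^ 2
  set r := ⟪x - a, rot90 (b - a)⟫ / ‖b - a‖ ^ 2
  rw [Metric.mem_closedBall, e, add_assoc, dist_self_add_left]
  calc _ ≤ ‖t • (b - a)‖ + ‖r • rot90 (b - a)‖ := norm_add_le _ _
    _ = (|t| + |r|) * ‖b - a‖ := by
        rw [norm_smul, norm_smul, norm_rot90, Real.norm_eq_abs, Real.norm_eq_abs]; ring
    _ ≤ 1 * ‖b - a‖ := by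
        gcongr
        rw [abs_of_nonneg (by linarith)]
        linarith
    _ = ‖b - a‖ := one_mul _

/-- The left half of the box lies in an element on the left of the edge. -/
lemma mem_of_mem_edgeBox {K : Element} {c : ℝ} (hab : 0 < dist a b) (hK : K.HasLeftBox c a b)
    {x : Plane} (hx : x ∈ edgeBox a b (c ^ 2 / 16)) (h : x ∈ halfPlane a (tangent a b)) :
    x ∈ K.carrier := by
  have hn : dist a b = ‖b - a‖ := by rw [dist_comm, dist_eq_norm]
  have h0 : 0 < ⟪x - a, rot90 (b - a)⟫ := by
    have h1 : 0 < ⟪x - a, rot90 (tangent a b)⟫ := h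
    have h2 : rot90 (tangent a b) = (dist a b)⁻¹ • rot90 (b - a) := by
      ext i; fin_cases i
      · simp [rot90, tangent]; ring
      · simp [rot90, tangent]
    rw [h2, inner_smul_right] at h1
    exact pos_of_mul_pos_right h1 (by positivity)
  rw [hn] at hab
  rw [eq_add_smul_rot90 a x hab.ne']
  exact hK _ hx.1 _ ⟨by positivity, hx.2.2⟩

lemma edgeBox_symm (hab : 0 < dist a b) : edgeBox a b δ ⊆ edgeBox b a δ := by
  intro x ⟨⟨h1, h2⟩, h3, h4⟩
  have hn : dist a b = ‖b - a‖ := by rw [dist_comm, dist_eq_norm]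
  rw [hn] at hab
  have e1 : ⟪x - b, a - b⟫ / ‖a - b‖ ^ 2 = 1 - ⟪x - a, b - a⟫ / ‖b - a‖ ^ 2 := by
    rw [norm_sub_rev a b, eq_sub_iff_add_eq, ← add_div, div_eq_one_iff_eq (by positivity),
      norm_sq_plane, inner_plane, inner_plane]
    simp; ring
  have e2 : ⟪x - b, rot90 (a - b)⟫ / ‖a - b‖ ^ 2 = -(⟪x - a, rot90 (b - a)⟫ / ‖b - a‖ ^ 2) := by
    rw [norm_sub_rev a b, ← neg_div, inner_rot90, inner_rot90]
    congr 1
    simp; ring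
  refine ⟨?_, ?_⟩
  · rw [e1]; constructor <;> linarith
  · rw [e2]; constructor <;> linarith

lemma halfPlane_neg_tangent_subset :
    halfPlane a (-tangent a b) ⊆ halfPlane b (tangent b a) := by
  intro x hx
  change 0 < ⟪x - a, rot90 (-tangent a b)⟫ at hx
  change 0 < ⟪x - b, rot90 (tangent b a)⟫
  rw [inner_rot90] at hx ⊢
  rw [tangent, dist_comm b a]
  simp [tangent] at hx ⊢
  linarith

end EdgeBox

/-- The restriction to a line of a component of a difference of polynomial fields. -/
lemma exists_restrict_jump {k : ℕ} {q q' : PolyField} (hq : IsPField k q) (hq' : IsPField k q')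
    (a w s : Plane) : ∃ P : Polynomial ℝ, P.natDegree ≤ k ∧
      ∀ t : ℝ, P.eval t = ⟪polyField q (a + t • w) - polyField q' (a + t • w), s⟫ := by
  obtain ⟨P, hP, hPe⟩ := exists_restrict_line
    (MvPolynomial.C (s 0) * (q 0 - q' 0) + MvPolynomial.C (s 1) * (q 1 - q' 1)) a w
  have hdeg : ∀ i, (MvPolynomial.C (s i) * (q i - q' i)).totalDegree ≤ k := fun i => by
    refine (MvPolynomial.totalDegree_mul _ _).trans ?_
    rw [MvPolynomial.totalDegree_C, zero_add]
    exact (MvPolynomial.totalDegree_sub _ _).trans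
      (max_le (hq i).totalDegree_le (hq' i).totalDegree_le)
  refine ⟨P, hP.trans ((MvPolynomial.totalDegree_add _ _).trans (max_le (hdeg 0) (hdeg 1))),
    fun t => ?_⟩
  rw [hPe, inner_plane]
  simp [polyFun, polyField]
  ring

lemma sqrt_mul_edgeNorm_le {a b : Plane} {g : Plane → ℝ} {M : ℝ} (hM : 0 ≤ M)
    (h : ∀ t ∈ Icc (0 : ℝ) 1, |g (AffineMap.lineMap a b t)| ≤ M) :
    Real.sqrt (dist a b) * edgeNorm a b g ≤ dist a b * M := by
  have h1 : ∫ t in (0 : ℝ)..1, g (AffineMap.lineMap a b t) ^ 2 ≤ M ^ 2 := by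
    rw [intervalIntegral.integral_of_le zero_le_one]
    calc _ ≤ ∫ _ in Ioc (0 : ℝ) 1, M ^ 2 := by
          refine integral_mono_of_nonneg (Filter.Eventually.of_forall fun _ => sq_nonneg _)
            (integrableOn_const (by simp)) ?_
          filter_upwards [ae_restrict_mem measurableSet_Ioc] with t ht
          rw [← sq_abs]
          have := h t ⟨ht.1.le, ht.2⟩
          gcongr
      _ = M ^ 2 := by simp
  rw [edgeNorm, edgeIntegral]
  calc _ ≤ Real.sqrt (dist a b) * Real.sqrt (dist a b * M ^ 2) := by gcongr
    _ = dist a b * M := by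
      rw [Real.sqrt_mul dist_nonneg, Real.sqrt_sq hM, ← mul_assoc,
        Real.mul_self_sqrt dist_nonneg]

/-- The jump residual is bounded by the error on the two adjacent elements: test with the jump,
extended constantly in the normal direction and multiplied by a bump function of the box. -/
theorem exists_jump_bound_of_sides (c : ℝ) (hc : 0 < c) (k : ℕ) : ∃ C : ℝ, 0 < C ∧
    ∀ (Ω : Set Plane) (T : Mesh Ω), IsOpen Ω → T.IsRegular c →
    ∀ (ζh : Fin T.m → PolyField) (ζ : Plane → Plane), (∀ i, IsPField k (ζh i)) →
      HasWeakRot Ω ζ 0 →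
    ∀ i j a b, T.IsInteriorEdge i j a b →
      (T.elem i).HasLeftBox c a b → (T.elem j).HasLeftBox c b a →
      Real.sqrt (dist a b) * edgeNorm a b (tangentialJump ζh i j a b) ≤
        C * (l2norm (T.elem i).carrier (fun x => ζ x - polyField (ζh i) x) +
          l2norm (T.elem j).carrier (fun x => ζ x - polyField (ζh j) x)) := by
  set δ := c ^ 2 / 16 with hδ
  have hδ0 : 0 < δ := by positivity
  obtain ⟨Ca, hCa, hrot⟩ := exists_rot_bound c hc k
  let β : ContDiffBump (1 / 2 : ℝ) := ⟨1 / 8, 1 / 4, by norm_num, by norm_num⟩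
  let β' : ContDiffBump (0 : ℝ) := ⟨δ / 2, δ, by positivity, by linarith⟩
  have hβs : ContDiff ℝ ∞ β := β.contDiff
  have hβs' : ContDiff ℝ ∞ β' := β'.contDiff
  obtain ⟨C₁, hC₁, hnorm⟩ := exists_polynomial_sq_le k β β.continuous β.hasCompactSupport
    (fun x => β.nonneg) ⟨1 / 2, β.pos_of_mem_ball (Metric.mem_ball_self β.rOut_pos)⟩
  obtain ⟨D, hD⟩ := β.hasCompactSupport.deriv.exists_bound_of_continuous
    (hβs.continuous_deriv (by simp))
  obtain ⟨D', hD'⟩ := β'.hasCompactSupport.deriv.exists_bound_of_continuous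
    (hβs'.continuous_deriv (by simp))
  have hD0 : 0 ≤ D := (norm_nonneg _).trans (hD 0)
  have hD0' : 0 ≤ D' := (norm_nonneg _).trans (hD' 0)
  set R := Real.sqrt Real.pi with hR
  refine ⟨C₁ * (R * (Ca + 2 * (1 + D + D'))) + 1, by positivity, ?_⟩
  intro Ω T hΩ hT ζh ζ hζh hζ i j a b hedge hi hj
  obtain ⟨hij, hei, hej, hopen⟩ := hedge
  set h := dist a b with hh
  have hh0 : 0 < h := hT.dist_pos hc hei
  have hc1 : c < 1 := by
    have h1 := (hT i).1 _ _ hei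
    have h2 := hei.dist_le
    have h3 := hT.diam_pos hc i
    by_contra! h4
    nlinarith
  have hδ1 : δ ≤ 1 / 16 := by rw [hδ]; nlinarith
  have hw : ‖b - a‖ = h := by rw [hh, dist_comm, dist_eq_norm]
  set s := tangent a b with hs
  have hs1 : ‖s‖ = 1 := norm_tangent hh0
  obtain ⟨P, hPk, hP⟩ := exists_restrict_jump (hζh i) (hζh j) a (b - a) s
  set J := ∫ t, β t * P.eval t ^ 2 with hJ
  have hJ0 : 0 ≤ J := integral_nonneg fun z => mul_nonneg β.nonneg (sq_nonneg _)
  set A := Real.sqrt (C₁ * J) with hA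
  have hA0 : 0 ≤ A := Real.sqrt_nonneg _
  have hA2 : A ^ 2 = C₁ * J := Real.sq_sqrt (by positivity)
  have hP0 : ∀ t ∈ Icc (0 : ℝ) 1, |P.eval t| ≤ A := fun t ht =>
    abs_le_of_sq_le_sq (by rw [hA2]; exact (hnorm P hPk t ht).1) hA0
  have hP1 : ∀ t ∈ Icc (0 : ℝ) 1, |P.derivative.eval t| ≤ A := fun t ht =>
    abs_le_of_sq_le_sq (by rw [hA2]; exact (hnorm P hPk t ht).2) hA0
  have hPs : ContDiff ℝ ∞ fun t => P.eval t := by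
    simpa using Polynomial.contDiff_aeval (𝕜 := ℝ) P ∞
  set Ψ : ℝ → ℝ := fun t => β t * P.eval t with hΨ
  have hΨs : ContDiff ℝ ∞ Ψ := hβs.mul hPs
  have hΨ1 : ∀ t ∈ Icc (0 : ℝ) 1, |deriv Ψ t| ≤ (1 + D) * A := by
    intro t ht
    have : deriv Ψ t = deriv β t * P.eval t + β t * P.derivative.eval t :=
      ((hβs.differentiable (by simp) t).hasDerivAt.mul (P.hasDerivAt t)).deriv
    rw [this]
    calc _ ≤ |deriv β t| * |P.eval t| + |β t| * |P.derivative.eval t| := by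
          rw [← abs_mul, ← abs_mul]; exact abs_add_le _ _
      _ ≤ D * A + 1 * A := by
          gcongr
          · exact hD t
          · exact hP0 t ht
          · rw [abs_of_nonneg β.nonneg]; exact β.le_one
          · exact hP1 t ht
      _ = _ := by ring
  have hΨ0 : ∀ t ∈ Icc (0 : ℝ) 1, |Ψ t| ≤ A := by
    intro t ht
    rw [hΨ, abs_mul, abs_of_nonneg β.nonneg]
    calc β t * |P.eval t| ≤ 1 * A := by
          gcongr
          · exact β.le_one
          · exact hP0 t ht
      _ = A := one_mul A
  set φ : Plane → ℝ := fun x => Ψ (⟪x - a, b - a⟫ / ‖b - a‖ ^ 2) *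
    β' (⟪x - a, rot90 (b - a)⟫ / ‖b - a‖ ^ 2) with hφ
  have hs1' : ContDiff ℝ ∞ fun x : Plane => Ψ (⟪x - a, b - a⟫ / ‖b - a‖ ^ 2) :=
    hΨs.comp (((contDiff_id.sub contDiff_const).inner ℝ contDiff_const).div_const _)
  have hs2' : ContDiff ℝ ∞ fun x : Plane => β' (⟪x - a, rot90 (b - a)⟫ / ‖b - a‖ ^ 2) :=
    hβs'.comp (((contDiff_id.sub contDiff_const).inner ℝ contDiff_const).div_const _)
  have hφs : ContDiff ℝ ∞ φ := hs1'.mul hs2'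
  -- the test function is supported in the box
  have hsupp : tsupport φ ⊆ edgeBox a b δ := by
    refine closure_minimal (fun x hx => ?_) (isClosed_edgeBox a b δ)
    have h1 := left_ne_zero_of_mul (left_ne_zero_of_mul hx)
    have h2 := right_ne_zero_of_mul hx
    have h1' : _ ∈ Function.support β := h1
    have h2' : _ ∈ Function.support β' := h2
    rw [β.support_eq, Real.ball_eq_Ioo] at h1'
    rw [β'.support_eq, Real.ball_eq_Ioo] at h2'
    refine ⟨⟨?_, ?_⟩, ⟨?_, ?_⟩⟩
    · linarith [h1'.1, show β.rOut = 1 / 4 from rfl]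
    · linarith [h1'.2, show β.rOut = 1 / 4 from rfl]
    · linarith [h2'.1, show β'.rOut = δ from rfl]
    · linarith [h2'.2, show β'.rOut = δ from rfl]
  have hball := edgeBox_subset_closedBall hh0 hδ1
  have hcs : HasCompactSupport φ := (isCompact_closedBall a h).of_isClosed_subset
    (isClosed_tsupport φ) (hsupp.trans hball)
  have hleft : tsupport φ ∩ halfPlane a s ⊆ (T.elem i).carrier := fun x hx =>
    mem_of_mem_edgeBox hh0 hi (hsupp hx.1) hx.2
  have hright : tsupport φ ∩ halfPlane a (-s) ⊆ (T.elem j).carrier := fun x hx =>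
    mem_of_mem_edgeBox (by rwa [dist_comm]) hj (edgeBox_symm hh0 (hsupp hx.1))
      (halfPlane_neg_tangent_subset hx.2)
  have hboxΩ : tsupport φ ⊆ Ω := by
    intro x hx
    by_cases hx1 : x ∈ halfPlane a s
    · exact T.subset i (hleft ⟨hx, hx1⟩)
    by_cases hx2 : x ∈ halfPlane a (-s)
    · exact T.subset j (hright ⟨hx, hx2⟩)
    -- the remaining points lie on the edge
    have h0 : ⟪x - a, rot90 s⟫ = 0 := by
      refine le_antisymm (not_lt.1 hx1) ?_
      have : ¬ 0 < ⟪x - a, rot90 (-s)⟫ := hx2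
      rw [rot90_neg, inner_neg_right] at this
      linarith
    have h1 : ⟪x - a, rot90 (b - a)⟫ = 0 := by
      rw [inner_rot90] at h0 ⊢
      rw [hs, tangent] at h0
      simp only [PiLp.smul_apply, smul_eq_mul] at h0
      have : h⁻¹ * ((x - a) 1 * (b - a) 0 - (x - a) 0 * (b - a) 1) = 0 := by linarith
      exact (mul_eq_zero.1 this).resolve_left (inv_ne_zero hh0.ne')
    refine hopen ?_
    rw [openSegment_eq_image']
    obtain ⟨⟨h2, h3⟩, -⟩ := hsupp hx
    refine ⟨⟪x - a, b - a⟫ / ‖b - a‖ ^ 2, ⟨?_, ?_⟩, ?_⟩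
    · linarith
    · linarith
    · have e := eq_add_smul_rot90 a x (w := b - a) (by rw [hw]; exact hh0.ne')
      rw [h1, zero_div, zero_smul, add_zero] at e
      exact e.symm
  -- bounds of the test function and its gradient
  have htI : ∀ x ∈ tsupport φ, ⟪x - a, b - a⟫ / ‖b - a‖ ^ 2 ∈ Icc (0 : ℝ) 1 := fun x hx =>
    ⟨by linarith [(hsupp hx).1.1], by linarith [(hsupp hx).1.2]⟩
  have hφ0 : ∀ x ∈ tsupport φ, |φ x| ≤ A := by
    intro x hx
    rw [hφ, abs_mul, abs_of_nonneg β'.nonneg]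
    calc _ ≤ A * 1 := by
          exact mul_le_mul (hΨ0 _ (htI x hx)) β'.le_one β'.nonneg hA0
      _ = A := mul_one A
  have hcurl : ∀ x ∈ tsupport φ, ‖curl φ x‖ ≤ 2 * ((1 + D + D') * A / h) := by
    intro x hx
    refine norm_curl_le fun m => ?_
    have hv : ∀ v : Plane, ‖v‖ = h → |v m / ‖b - a‖ ^ 2| ≤ 1 / h := by
      intro v hv
      rw [abs_div, hw, abs_of_pos (pow_pos hh0 2), div_le_div_iff₀ (by positivity) hh0]
      nlinarith [abs_coord_le v m]
    rw [hφ, pd_mul (hs1'.differentiable (by simp) x) (hs2'.differentiable (by simp) x),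
      pd_comp_coord (hΨs.differentiable (by simp)), pd_comp_coord (hβs'.differentiable (by simp))]
    calc _ ≤ |Ψ (⟪x - a, b - a⟫ / ‖b - a‖ ^ 2)| *
            (|deriv β' (⟪x - a, rot90 (b - a)⟫ / ‖b - a‖ ^ 2)| * |rot90 (b - a) m / ‖b - a‖ ^ 2|) +
          (|deriv Ψ (⟪x - a, b - a⟫ / ‖b - a‖ ^ 2)| * |(b - a) m / ‖b - a‖ ^ 2|) *
            |β' (⟪x - a, rot90 (b - a)⟫ / ‖b - a‖ ^ 2)| := by
          rw [← abs_mul, ← abs_mul, ← abs_mul, ← abs_mul]; exact abs_add_le _ _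
      _ ≤ A * (D' * (1 / h)) + ((1 + D) * A * (1 / h)) * 1 := by
          gcongr
          · exact hΨ0 _ (htI x hx)
          · exact hD' _
          · exact hv _ ((norm_rot90 _).trans hw)
          · exact hΨ1 _ (htI x hx)
          · exact hv _ hw
          · rw [abs_of_nonneg β'.nonneg]; exact β'.le_one
      _ = (1 + D + D') * A / h := by ring
  -- the terms of the error identity
  have hterm : ∀ (l : Fin T.m) (s' : Plane),
      tsupport φ ∩ halfPlane a s' ⊆ (T.elem l).carrier → h ≤ (T.elem l).diam →
      |∫ x in tsupport φ ∩ halfPlane a s', polyFun (polyRot (ζh l)) x * φ x| +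
        |∫ x in tsupport φ ∩ halfPlane a s', ⟪ζ x - polyField (ζh l) x, curl φ x⟫| ≤
      R * (Ca + 2 * (1 + D + D')) * A *
        l2norm (T.elem l).carrier (fun x => ζ x - polyField (ζh l) x) := by
    -- the element residual is bounded by the error, and `h ≤ h_K`
    intro l s' hsub hle
    set e := l2norm (T.elem l).carrier (fun x => ζ x - polyField (ζh l) x) with he
    have he0 : 0 ≤ e := l2norm_nonneg
    have hm : MeasurableSet (tsupport φ ∩ halfPlane a s') :=
      hcs.isCompact.measurableSet.inter (measurableSet_halfPlane a s')
    have hvol := volume_le_of_subset_closedBall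
      ((inter_subset_left (t := halfPlane a s')).trans (hsupp.trans hball)) hh0.le
    have hL1 : IsL2 (T.elem l).carrier (polyFun (polyRot (ζh l))) :=
      isL2_of_continuous (continuous_polyFun _) (T.elem l).isBounded
    have hL2 : IsL2 (T.elem l).carrier (fun x => ζ x - polyField (ζh l) x) :=
      (hζ.isL2.mono (T.subset l)).sub
        (isL2_of_continuous (continuous_polyField _) (T.elem l).isBounded)
    have b1 := abs_setIntegral_le_l2norm hm (hL1.mono hsub) hA0 (by positivity) hvol
      (F := fun x => polyFun (polyRot (ζh l)) x * φ x) (fun x hx => by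
        rw [abs_mul, mul_comm]
        exact mul_le_mul_of_nonneg_right (hφ0 x hx.1) (abs_nonneg _))
    have b2 := abs_setIntegral_le_l2norm hm (hL2.mono hsub)
      (M := 2 * ((1 + D + D') * A / h)) (by positivity) (by positivity) hvol
      (F := fun x => ⟪ζ x - polyField (ζh l) x, curl φ x⟫) (fun x hx => by
        refine (abs_real_inner_le_norm _ _).trans ?_
        rw [mul_comm]
        exact mul_le_mul_of_nonneg_right (hcurl x hx.1) (norm_nonneg _))
    rw [sqrt_sq_mul_pi hh0.le] at b1 b2
    have m1 := l2norm_mono hsub hL1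
    have m2 := l2norm_mono hsub hL2
    have m3 := hrot Ω T hΩ hT (ζh l) ζ (hζh l) hζ l
    have n1 : 0 ≤ l2norm (T.elem l).carrier (polyFun (polyRot (ζh l))) := l2norm_nonneg
    have c1 : A * (h * R) * l2norm (tsupport φ ∩ halfPlane a s') (polyFun (polyRot (ζh l))) ≤
        A * R * (Ca * e) := by
      calc _ ≤ A * (h * R) * l2norm (T.elem l).carrier (polyFun (polyRot (ζh l))) := by gcongr
        _ = A * R * (h * l2norm (T.elem l).carrier (polyFun (polyRot (ζh l)))) := by ring
        _ ≤ A * R * ((T.elem l).diam * l2norm (T.elem l).carrier (polyFun (polyRot (ζh l)))) := by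
            gcongr
        _ ≤ _ := by gcongr
    have c2 : 2 * ((1 + D + D') * A / h) * (h * R) * l2norm (tsupport φ ∩ halfPlane a s')
        (fun x => ζ x - polyField (ζh l) x) ≤ 2 * (1 + D + D') * A * R * e := by
      calc _ ≤ 2 * ((1 + D + D') * A / h) * (h * R) * e := by gcongr
        _ = _ := by field_simp
    calc _ ≤ A * R * (Ca * e) + 2 * (1 + D + D') * A * R * e :=
          add_le_add (b1.trans c1) (b2.trans c2)
      _ = _ := by ring
  have hid := integral_jump_eq hΩ hζ ⟨hφs, hcs, hboxΩ⟩ a hs1 (ζh i) (ζh j)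
  -- on the edge, the test function is the jump times `β`
  have hlhs : ∫ u : ℝ, φ (a + u • s) *
      ⟪polyField (ζh i) (a + u • s) - polyField (ζh j) (a + u • s), s⟫ = h * J := by
    have e1 : ∀ u : ℝ, u • s = (h⁻¹ * u) • (b - a) := by
      intro u; rw [hs, tangent, smul_smul, mul_comm]
    have e2 : ∀ t : ℝ, φ (a + t • (b - a)) = Ψ t := by
      intro t
      have z1 : ⟪a + t • (b - a) - a, b - a⟫ / ‖b - a‖ ^ 2 = t := by
        rw [add_sub_cancel_left, real_inner_smul_left, real_inner_self_eq_norm_sq, hw]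
        field_simp
      have z2 : ⟪a + t • (b - a) - a, rot90 (b - a)⟫ / ‖b - a‖ ^ 2 = 0 := by
        rw [add_sub_cancel_left, real_inner_smul_left, inner_rot90_self, mul_zero, zero_div]
      simp only [hφ, z1, z2]
      rw [β'.one_of_mem_closedBall (Metric.mem_closedBall_self β'.rIn_pos.le), mul_one]
    simp only [e1, e2, ← hP]
    rw [Measure.integral_comp_inv_mul_left (fun t => Ψ t * P.eval t) h, abs_of_pos hh0,
      smul_eq_mul, hJ]
    congr 2
    ext t
    simp only [hΨ]; ring
  set ei := l2norm (T.elem i).carrier (fun x => ζ x - polyField (ζh i) x) with hei'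
  set ej := l2norm (T.elem j).carrier (fun x => ζ x - polyField (ζh j) x) with hej'
  have hei0 : 0 ≤ ei := l2norm_nonneg
  have hej0 : 0 ≤ ej := l2norm_nonneg
  have hJle : h * J ≤ R * (Ca + 2 * (1 + D + D')) * A * (ei + ej) := by
    rw [← hlhs, hid]
    have t1 := hterm i s hleft hei.dist_le
    have t2 := hterm j (-s) hright hej.dist_le
    have d1 := le_abs_self (∫ x in tsupport φ ∩ halfPlane a s, polyFun (polyRot (ζh i)) x * φ x)
    have d2 := le_abs_self
      (∫ x in tsupport φ ∩ halfPlane a (-s), polyFun (polyRot (ζh j)) x * φ x)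
    have d3 := le_abs_self
      (∫ x in tsupport φ ∩ halfPlane a s, ⟪ζ x - polyField (ζh i) x, curl φ x⟫)
    have d4 := le_abs_self
      (∫ x in tsupport φ ∩ halfPlane a (-s), ⟪ζ x - polyField (ζh j) x, curl φ x⟫)
    linarith
  have hAle : A ≤ C₁ * (R * (Ca + 2 * (1 + D + D'))) * (ei + ej) / h := by
    refine le_of_sq_le_mul (by positivity) ?_
    rw [hA2, div_mul_eq_mul_div, le_div_iff₀ hh0]
    calc C₁ * J * h = C₁ * (h * J) := by ring
      _ ≤ C₁ * (R * (Ca + 2 * (1 + D + D')) * A * (ei + ej)) := by gcongr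
      _ = _ := by ring
  have hedgeN : Real.sqrt h * edgeNorm a b (tangentialJump ζh i j a b) ≤ h * A := by
    refine sqrt_mul_edgeNorm_le hA0 fun t ht => ?_
    have : tangentialJump ζh i j a b (AffineMap.lineMap a b t) = P.eval t := by
      rw [hP, tangentialJump, AffineMap.lineMap_apply, vsub_eq_sub, vadd_eq_add, add_comm]
    rw [this]
    exact hP0 t ht
  calc _ ≤ h * A := hedgeN
    _ ≤ h * (C₁ * (R * (Ca + 2 * (1 + D + D'))) * (ei + ej) / h) := by gcongr
    _ = C₁ * (R * (Ca + 2 * (1 + D + D'))) * (ei + ej) := by field_simp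
    _ ≤ _ := by nlinarith

/-! ### The residual bounds on a mesh -/

section Mesh

variable {Ω : Set Plane} {T : Mesh Ω}

lemma Mesh.patch_subset (T : Mesh Ω) (a b : Plane) : T.patch a b ⊆ Ω :=
  iUnion₂_subset fun i _ => T.subset i

lemma Mesh.measurableSet_patch (T : Mesh Ω) (a b : Plane) : MeasurableSet (T.patch a b) :=
  (isOpen_iUnion fun i => isOpen_iUnion fun _ => (T.elem i).isOpen).measurableSet

lemma Mesh.exists_mem_of_mem_patch {a b x : Plane} (h : x ∈ T.patch a b) :
    ∃ i, x ∈ (T.elem i).carrier := by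
  obtain ⟨i, -, hi⟩ := mem_iUnion₂.1 h
  exact ⟨i, hi⟩

lemma Mesh.isL2_glue (hΩ : Bornology.IsBounded Ω) (q : Fin T.m → PolyField) :
    IsL2 Ω (T.glue fun i => polyField (q i)) :=
  memLp_finsetSum _ fun i _ => MemLp.indicator (T.elem i).isOpen.measurableSet
    (isL2_of_continuous (continuous_polyField (q i)) hΩ)

lemma edgeNorm_tangentialJump_comm {m : ℕ} (q : Fin m → PolyField) (i j : Fin m) (a b : Plane) :
    edgeNorm a b (tangentialJump q i j a b) = edgeNorm a b (tangentialJump q j i a b) := by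
  have : ∀ x, tangentialJump q i j a b x ^ 2 = tangentialJump q j i a b x ^ 2 := fun x => by
    rw [tangentialJump, tangentialJump, ← neg_sub, inner_neg_left, neg_sq]
  simp only [edgeNorm, this]

/-- The residual bounds for an arbitrary piecewise polynomial field. -/
theorem exists_residual_bounds (c : ℝ) (hc : 0 < c) (k : ℕ) : ∃ C : ℝ, 0 < C ∧
    ∀ (Ω : Set Plane) (T : Mesh Ω), IsPolygonalDomain Ω → T.IsRegular c →
    ∀ (ζh : Fin T.m → PolyField) (ζ : Plane → Plane),
      (∀ i, IsPField k (ζh i)) → HasWeakRot Ω ζ 0 →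
      (∀ i, (T.elem i).diam * l2norm (T.elem i).carrier (polyFun (polyRot (ζh i))) ≤
        C * l2norm (T.elem i).carrier
          (fun x => ζ x - T.glue (fun i => polyField (ζh i)) x)) ∧
      (∀ i j a b, T.IsInteriorEdge i j a b →
        Real.sqrt (dist a b) * edgeNorm a b (tangentialJump ζh i j a b) ≤
          C * l2norm (T.patch a b)
            (fun x => ζ x - T.glue (fun i => polyField (ζh i)) x)) := by
  obtain ⟨C, hC, h⟩ := exists_rot_bound c hc k
  obtain ⟨C', hC', h'⟩ := exists_jump_bound_of_sides c hc k
  refine ⟨C + 2 * C', by positivity, fun Ω T hΩ hT ζh ζ hζh hζ => ⟨fun i => ?_, ?_⟩⟩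
  · have e : l2norm (T.elem i).carrier (fun x => ζ x - T.glue (fun i => polyField (ζh i)) x) =
        l2norm (T.elem i).carrier (fun x => ζ x - polyField (ζh i) x) :=
      l2norm_congr (T.elem i).isOpen.measurableSet fun x hx => by rw [T.glue_of_mem _ hx]
    rw [e]
    refine (h Ω T hΩ.isOpen hT (ζh i) ζ (hζh i) hζ i).trans ?_
    have := l2norm_nonneg (S := (T.elem i).carrier) (f := fun x => ζ x - polyField (ζh i) x)
    gcongr
    linarith
  · intro i j a b hedge
    set E := l2norm (T.patch a b) (fun x => ζ x - T.glue (fun i => polyField (ζh i)) x) with hE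
    have hE0 : 0 ≤ E := l2norm_nonneg
    have hL2 : IsL2 (T.patch a b) (fun x => ζ x - T.glue (fun i => polyField (ζh i)) x) :=
      IsL2.mono (hζ.isL2.sub (T.isL2_glue hΩ.isBounded ζh)) (T.patch_subset a b)
    have hle : ∀ l, (T.elem l).IsEdge a b →
        l2norm (T.elem l).carrier (fun x => ζ x - polyField (ζh l) x) ≤ E := by
      intro l hl
      have e : l2norm (T.elem l).carrier (fun x => ζ x - polyField (ζh l) x) =
          l2norm (T.elem l).carrier (fun x => ζ x - T.glue (fun i => polyField (ζh i)) x) :=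
        l2norm_congr (T.elem l).isOpen.measurableSet fun x hx => by rw [T.glue_of_mem _ hx]
      rw [e]
      exact l2norm_mono (subset_iUnion₂ (s := fun i _ => (T.elem i).carrier) l hl) hL2
    have hi := hle i hedge.2.1
    have hj := hle j hedge.2.2.1
    rcases hT.hasLeftBox_and_or hc hedge with ⟨h1, h2⟩ | ⟨h1, h2⟩
    · refine (h' Ω T hΩ.isOpen hT ζh ζ hζh hζ i j a b hedge h1 h2).trans ?_
      nlinarith
    · have hedge' : T.IsInteriorEdge j i a b :=
        ⟨hedge.1.symm, hedge.2.2.1, hedge.2.1, hedge.2.2.2⟩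
      rw [edgeNorm_tangentialJump_comm]
      refine (h' Ω T hΩ.isOpen hT ζh ζ hζh hζ j i a b hedge' h1 h2).trans ?_
      nlinarith

end Mesh

/-! ### The field `κ⁻¹ σ` of the mixed problem has no rotation -/

lemma pd_comm {v : Plane → ℝ} (hv : ContDiff ℝ ∞ v) (i j : Fin 2) (x : Plane) :
    pd i (pd j v) x = pd j (pd i v) x := by
  have hsymm : IsSymmSndFDerivAt ℝ v x :=
    hv.contDiffAt.isSymmSndFDerivAt (by
      rw [minSmoothness_of_isRCLikeNormedField]
      exact WithTop.coe_le_coe.2 (le_top (a := (2 : ℕ∞))))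
  have hd : DifferentiableAt ℝ (fderiv ℝ v) x :=
    (hv.fderiv_right (m := ∞) (by simp)).differentiable (by simp) x
  have h : ∀ i j, pd i (pd j v) x =
      fderiv ℝ (fderiv ℝ v) x (EuclideanSpace.single i 1) (EuclideanSpace.single j 1) := by
    intro i j
    have h1 : pd j v = fun y => fderiv ℝ v y (EuclideanSpace.single j 1) := rfl
    rw [pd, h1, fderiv_clm_apply hd (differentiableAt_const _)]
    simp
  rw [h, h, hsymm]

lemma IsTest.pd {U : Set Plane} {φ : Plane → ℝ} (h : IsTest U φ) (i : Fin 2) :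
    IsTest U (MixedVEM.pd i φ) :=
  ⟨contDiff_pd h.1 i, hasCompactSupport_pd h.2.1 i,
    (tsupport_fderiv_apply_subset ℝ _).trans h.2.2⟩

/-- Smooth functions have their classical gradient as a weak gradient. -/
lemma hasWeakGrad_of_contDiff {Ω : Set Plane} (hb : Bornology.IsBounded Ω)
    {v : Plane → ℝ} (hv : ContDiff ℝ ∞ v) : HasWeakGrad Ω v (grad v) where
  isL2 := isL2_of_continuous hv.continuous hb
  isL2_grad := by
    refine isL2_of_continuous ((PiLp.continuous_toLp 2 _).comp (continuous_pi fun i => ?_)) hb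
    fin_cases i
    · exact (contDiff_pd hv 0).continuous
    · exact (contDiff_pd hv 1).continuous
  weak := fun φ hφ i => by
    have e1 : ∫ x in Ω, v x * pd i φ x = ∫ x, v x * pd i φ x :=
      setIntegral_eq_integral_of_forall_compl_eq_zero fun x hx => by
        rw [image_eq_zero_of_notMem_tsupport fun h => hx ((hφ.pd i).2.2 h), mul_zero]
    have e2 : ∫ x in Ω, grad v x i * φ x = ∫ x, pd i v x * φ x := by
      rw [setIntegral_eq_integral_of_forall_compl_eq_zero fun x hx => by
        rw [image_eq_zero_of_notMem_tsupport fun h => hx (hφ.2.2 h), mul_zero]]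
      congr 1; ext x
      fin_cases i <;> rfl
    rw [e1, e2, integral_mul_pd hv hφ.1 hφ.2.1]

lemma IsL2.coord {S : Set Plane} {f : Plane → Plane} (h : IsL2 S f) (i : Fin 2) :
    IsL2 S fun x => f x i :=
  MemLp.of_le h ((EuclideanSpace.proj i : Plane →L[ℝ] ℝ).continuous.comp_aestronglyMeasurable h.1)
    (Filter.Eventually.of_forall fun x => PiLp.norm_apply_le (f x) i)

/-- Gradients are orthogonal to the rotations of test functions. -/
lemma HasWeakGrad.integral_curl_eq_zero {Ω : Set Plane} (hb : Bornology.IsBounded Ω)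
    {G : Plane → ℝ} {G' : Plane → Plane} (hG : HasWeakGrad Ω G G') {φ : Plane → ℝ}
    (hφ : IsTest Ω φ) : ∫ x in Ω, ⟪curl φ x, G' x⟫ = 0 := by
  have hi : ∀ i j, Integrable (fun x => G' x i * pd j φ x) (volume.restrict Ω) := fun i j =>
    (hG.isL2_grad.coord i).integrable_mul
      (isL2_of_continuous (contDiff_pd hφ.1 j).continuous hb)
  have e : ∀ x, ⟪curl φ x, G' x⟫ = G' x 0 * pd 1 φ x - G' x 1 * pd 0 φ x := fun x => by
    rw [real_inner_comm, inner_curl]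
  have h0 := hG.weak _ (hφ.pd 1) 0
  have h1 := hG.weak _ (hφ.pd 0) 1
  simp only [pd_comm hφ.1 0 1] at h0
  simp only [e]
  rw [integral_sub (hi 0 1) (hi 1 0)]
  linarith

lemma isL2_curl {Ω : Set Plane} (hb : Bornology.IsBounded Ω) {φ : Plane → ℝ}
    (hφ : ContDiff ℝ ∞ φ) : IsL2 Ω (curl φ) :=
  isL2_of_continuous (continuous_curl hφ) hb

/-- Rotations of test functions are admissible divergence-free fluxes. -/
lemma memH_curl {Ω ΓD : Set Plane} (hb : Bornology.IsBounded Ω) {φ : Plane → ℝ}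
    (hφ : IsTest Ω φ) : MemH Ω ΓD (curl φ) 0 := by
  have h0 : ∀ v : Plane → ℝ, ContDiff ℝ ∞ v → ∫ x in Ω, ⟪curl φ x, grad v x⟫ = 0 := fun v hv =>
    (hasWeakGrad_of_contDiff hb hv).integral_curl_eq_zero hb hφ
  refine ⟨⟨isL2_curl hb hφ.1, MemLp.zero, fun ψ hψ => ?_⟩, fun v hv _ => ?_⟩
  · rw [h0 ψ hψ.1]; simp
  · simpa using h0 v hv

/-- By uniform positive definiteness, the inverse diffusion matrix acts boundedly on `L²`. -/
lemma IsDiffusion.exists_inv_bound {Ω : Set Plane} {κ : Plane → Matrix (Fin 2) (Fin 2) ℝ}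
    (hκ : IsDiffusion Ω κ) : ∃ C : ℝ, 0 < C ∧ ∀ S ⊆ Ω, ∀ f : Plane → Plane, IsL2 S f →
      IsL2 S (fun x => app (κ x)⁻¹ (f x)) ∧
        l2norm S (fun x => app (κ x)⁻¹ (f x)) ≤ C * l2norm S f := by
  obtain ⟨c, hc, hpos⟩ := hκ.posDef
  refine ⟨c⁻¹, inv_pos.2 hc, fun S hS f hf => ?_⟩
  have hbound : ∀ᵐ x ∂volume.restrict S, ‖app (κ x)⁻¹ (f x)‖ ≤ c⁻¹ * ‖f x‖ := by
    filter_upwards [ae_mono (Measure.restrict_mono hS le_rfl) hpos] with x hx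
    have hdet : IsUnit (κ x).det := by
      rw [isUnit_iff_ne_zero]
      intro h0
      obtain ⟨v, hv0, hv⟩ := Matrix.exists_mulVec_eq_zero_iff.2 h0
      have := hx (WithLp.toLp 2 v)
      rw [app, hv, WithLp.toLp_zero, inner_zero_left] at this
      have hn : ‖WithLp.toLp 2 v‖ ≠ 0 := norm_ne_zero_iff.2 (by simpa using hv0)
      have : 0 < c * ‖WithLp.toLp 2 v‖ ^ 2 := by positivity
      linarith
    have hinv : app (κ x) (app (κ x)⁻¹ (f x)) = f x := by
      change WithLp.toLp 2 ((κ x).mulVec ((κ x)⁻¹.mulVec (f x).ofLp)) = f x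
      rw [Matrix.mulVec_mulVec, Matrix.mul_nonsing_inv _ hdet, Matrix.one_mulVec]
    have h1 := hx (app (κ x)⁻¹ (f x))
    rw [hinv] at h1
    have h2 := h1.trans (real_inner_le_norm _ _)
    rw [inv_mul_eq_div, le_div_iff₀ hc]
    rcases (norm_nonneg (app (κ x)⁻¹ (f x))).eq_or_lt with h3 | h3
    · rw [← h3]; simp
    · nlinarith
  have hent : ∀ i j, AEMeasurable (fun x => (κ x)⁻¹ i j) (volume.restrict S) := by
    have hm : ∀ i j, AEMeasurable (fun x => κ x i j) (volume.restrict S) := fun i j =>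
      (hκ.memLp i j).1.aemeasurable.mono_measure (Measure.restrict_mono hS le_rfl)
    have hd : AEMeasurable (fun x => (κ x).det) (volume.restrict S) := by
      simp only [Matrix.det_fin_two]
      exact ((hm 0 0).mul (hm 1 1)).sub ((hm 0 1).mul (hm 1 0))
    intro i j
    simp only [Matrix.inv_def, Ring.inverse_eq_inv', Matrix.adjugate_fin_two, Matrix.smul_apply,
      smul_eq_mul]
    fin_cases i <;> fin_cases j
    · exact hd.inv.mul (hm 1 1)
    · exact hd.inv.mul (hm 0 1).neg
    · exact hd.inv.mul (hm 1 0).neg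
    · exact hd.inv.mul (hm 0 0)
  have hmeas : AEStronglyMeasurable (fun x => app (κ x)⁻¹ (f x)) (volume.restrict S) := by
    refine (PiLp.continuous_toLp 2 (fun _ : Fin 2 => ℝ)).comp_aestronglyMeasurable
      (AEMeasurable.aestronglyMeasurable (aemeasurable_pi_iff.2 fun i => ?_))
    simp only [Matrix.mulVec, dotProduct, Fin.sum_univ_two]
    exact ((hent i 0).mul (hf.coord 0).1.aemeasurable).add
      ((hent i 1).mul (hf.coord 1).1.aemeasurable)
  refine ⟨MemLp.of_le_mul hf hmeas hbound, ?_⟩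
  have hint : Integrable (fun x => ‖f x‖ ^ 2) (volume.restrict S) :=
    (memLp_two_iff_integrable_sq_norm hf.1).1 hf
  have : ∫ x in S, ‖app (κ x)⁻¹ (f x)‖ ^ 2 ≤ c⁻¹ ^ 2 * ∫ x in S, ‖f x‖ ^ 2 := by
    rw [← integral_const_mul]
    refine integral_mono_of_nonneg (Filter.Eventually.of_forall fun _ => sq_nonneg _)
      (hint.const_mul _) ?_
    filter_upwards [hbound] with x hx
    rw [← mul_pow]
    gcongr
  rw [l2norm, l2norm]
  calc _ ≤ Real.sqrt (c⁻¹ ^ 2 * ∫ x in S, ‖f x‖ ^ 2) := Real.sqrt_le_sqrt this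
    _ = _ := by rw [Real.sqrt_mul (by positivity), Real.sqrt_sq (by positivity)]

/-- The first equation of the mixed problem, tested with rotations of test functions, says that
`κ⁻¹ σ` has no rotation. -/
lemma IsMixedSolution.hasWeakRot {Ω ΓD : Set Plane} {κ : Plane → Matrix (Fin 2) (Fin 2) ℝ}
    {f G : Plane → ℝ} {G' σ : Plane → Plane} {σ' u : Plane → ℝ}
    (h : IsMixedSolution Ω ΓD κ f G G' σ σ' u) (hb : Bornology.IsBounded Ω)
    (hκ : IsDiffusion Ω κ) (hG : HasWeakGrad Ω G G') :
    HasWeakRot Ω (fun x => app (κ x)⁻¹ (σ x)) 0 := by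
  obtain ⟨C, hC, hinv⟩ := hκ.exists_inv_bound
  refine ⟨(hinv Ω subset_rfl σ h.memH.hasWeakDiv.isL2).1, MemLp.zero, fun φ hφ => ?_⟩
  have h1 := h.eq_flux (curl φ) 0 (memH_curl hb hφ)
  simp only [aForm, boundaryPairing, Pi.zero_apply, mul_zero, zero_mul, add_zero,
    integral_zero] at h1
  rw [h1, hG.integral_curl_eq_zero hb hφ]
  simp

/-! ### The error indicators -/

lemma isPField_mulVec {A : Matrix (Fin 2) (Fin 2) (MvPolynomial (Fin 2) ℝ)} {q : PolyField}
    {k m : ℕ} (hA : ∀ r s, IsP m (A r s)) (hq : IsPField ((k : ℤ) + 1) q) :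
    IsPField ((m + (k + 1) : ℕ) : ℤ) (A.mulVec q) := by
  intro i
  right
  norm_cast
  rw [Matrix.mulVec, dotProduct]
  refine MvPolynomial.totalDegree_finsetSum_le fun j _ => ?_
  refine (MvPolynomial.totalDegree_mul _ _).trans (add_le_add (hA i j).totalDegree_le ?_)
  exact IsP.totalDegree_le (by exact_mod_cast hq j)

lemma polyField_mulVec (A : Matrix (Fin 2) (Fin 2) (MvPolynomial (Fin 2) ℝ)) (q : PolyField)
    (x : Plane) : polyField (A.mulVec q) x = app (polyMatrix A x) (polyField q x) := by
  ext i
  fin_cases i <;> simp [polyField, app, polyMatrix, polyFun, Matrix.mulVec, dotProduct]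

/-- The error of `κ_h σ_h^⋆` as an approximation of `κ⁻¹ σ`. -/
lemma IsDiffusion.exists_errOscSq_bound {Ω : Set Plane} {κ : Plane → Matrix (Fin 2) (Fin 2) ℝ}
    (hκ : IsDiffusion Ω κ) (hb : Bornology.IsBounded Ω) : ∃ C : ℝ, 0 < C ∧
      ∀ (T : Mesh Ω) (κh : Fin T.m → Matrix (Fin 2) (Fin 2) (MvPolynomial (Fin 2) ℝ))
        (σ : Plane → Plane) (σs : Fin T.m → PolyField), IsL2 Ω σ →
      ∀ S ⊆ Ω, MeasurableSet S → (∀ x ∈ S, ∃ i, x ∈ (T.elem i).carrier) →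
        l2norm S (fun x => app (κ x)⁻¹ (σ x) -
          T.glue (fun i => polyField ((κh i).mulVec (σs i))) x) ^ 2 ≤
        C * T.errOscSq κ κh σ σs S := by
  obtain ⟨C, hC, hinv⟩ := hκ.exists_inv_bound
  refine ⟨C ^ 2 + 1, by positivity, fun T κh σ σs hσ S hS hSm hcov => ?_⟩
  have hσS := hσ.mono hS
  have hd : IsL2 S (fun x => σ x - T.glue (fun i => polyField (σs i)) x) :=
    hσS.sub ((T.isL2_glue hb σs).mono hS)
  obtain ⟨h1, h2⟩ := hinv S hS _ hd
  set osc := T.glue fun i x => app ((κ x)⁻¹ - polyMatrix (κh i) x) (polyField (σs i) x) with hosc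
  have hpt : ∀ x ∈ S, app (κ x)⁻¹ (σ x) - T.glue (fun i => polyField ((κh i).mulVec (σs i))) x =
      app (κ x)⁻¹ (σ x - T.glue (fun i => polyField (σs i)) x) + osc x := by
    intro x hx
    obtain ⟨i, hi⟩ := hcov x hx
    rw [hosc, T.glue_of_mem _ hi, T.glue_of_mem _ hi, T.glue_of_mem _ hi, polyField_mulVec]
    ext j
    fin_cases j <;> simp [app, Matrix.mulVec_sub, Matrix.sub_mulVec]
  have h3 : IsL2 S osc := by
    have h4 : IsL2 S fun x => (app (κ x)⁻¹ (σ x) -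
        T.glue (fun i => polyField ((κh i).mulVec (σs i))) x) -
          app (κ x)⁻¹ (σ x - T.glue (fun i => polyField (σs i)) x) :=
      ((hinv S hS _ hσS).1.sub ((T.isL2_glue hb _).mono hS)).sub h1
    refine h4.ae_eq ?_
    filter_upwards [ae_restrict_mem hSm] with x hx
    rw [hpt x hx, add_sub_cancel_left]
  rw [l2norm_congr hSm hpt]
  have h5 := (l2norm_add_le h1 h3).trans (add_le_add_left h2 _)
  rw [Mesh.errOscSq, ← hosc]
  set E := l2norm S (fun x => σ x - T.glue (fun i => polyField (σs i)) x)
  set O := l2norm S osc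
  calc _ ≤ (C * E + O) ^ 2 := pow_le_pow_left₀ l2norm_nonneg h5 2
    _ ≤ _ := by nlinarith [sq_nonneg (E - C * O)]

end MixedVEM

theorem mainTheorem3 :
    -- the bounds for a general piecewise polynomial field `ζh`
    (∀ (cT : ℝ) (k : ℕ), 0 < cT → ∃ C : ℝ, 0 < C ∧
      ∀ (Ω : Set Plane) (T : Mesh Ω), IsPolygonalDomain Ω → T.IsRegular cT →
      ∀ (ζh : Fin T.m → PolyField) (ζ : Plane → Plane),
        (∀ i, IsPField k (ζh i)) → HasWeakRot Ω ζ 0 →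
        (∀ i, (T.elem i).diam * l2norm (T.elem i).carrier (polyFun (polyRot (ζh i))) ≤
          C * l2norm (T.elem i).carrier
            (fun x => ζ x - T.glue (fun i => polyField (ζh i)) x)) ∧
        (∀ i j a b, T.IsInteriorEdge i j a b →
          Real.sqrt (dist a b) * edgeNorm a b (tangentialJump ζh i j a b) ≤
            C * l2norm (T.patch a b)
              (fun x => ζ x - T.glue (fun i => polyField (ζh i)) x))) ∧
    -- the bounds for the error indicators
    (∀ (Ω ΓD ΓN : Set Plane) (κ : Plane → Matrix (Fin 2) (Fin 2) ℝ) (cT : ℝ) (k m : ℕ),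
      IsPolygonalDomain Ω → IsBoundaryPartition Ω ΓD ΓN → IsDiffusion Ω κ → 0 < cT →
      ∃ C : ℝ, 0 < C ∧
      ∀ (f G : Plane → ℝ) (G' σ : Plane → Plane) (σ' u : Plane → ℝ),
        IsL2 Ω f → HasWeakGrad Ω G G' → IsMixedSolution Ω ΓD κ f G G' σ σ' u →
      ∀ (T : Mesh Ω), T.IsRegular cT → T.IsCompatible ΓD ΓN →
      ∀ (c₀ c₁ : ℝ) (S : Fin T.m → LinearMap.BilinForm ℝ (Plane → Plane)), 0 < c₀ → 0 < c₁ →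
        (∀ i, IsStabilization κ (T.elem i) k c₀ c₁ (S i)) →
      ∀ (σh : Plane → Plane) (σh' : Plane → ℝ) (uh : Fin T.m → MvPolynomial (Fin 2) ℝ)
        (σs : Fin T.m → PolyField)
        (κh : Fin T.m → Matrix (Fin 2) (Fin 2) (MvPolynomial (Fin 2) ℝ)),
        T.IsDiscreteSolution ΓD k κ S f G G' σh σh' uh → T.IsPostprocessed k σh σh' σs →
        (∀ i r s, IsP m (κh i r s)) →
        (∀ i, T.thetaOneSq (fun l => (κh l).mulVec (σs l)) i ≤
          C * T.errOscSq κ κh σ σs (T.elem i).carrier) ∧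
        (∀ i j a b, T.IsInteriorEdge i j a b →
          dist a b * edgeNorm a b
              (tangentialJump (fun l => (κh l).mulVec (σs l)) i j a b) ^ 2 ≤
            C * T.errOscSq κ κh σ σs (T.patch a b)) ∧
        (∀ i, T.thetaTwoSq (fun l => (κh l).mulVec (σs l)) i ≤
          C * ∑ l : Fin ((T.elem i).n + 3), open Classical in
            if openSegment ℝ ((T.elem i).vertex l) ((T.elem i).vertex (l + 1)) ⊆ Ω then
              T.errOscSq κ κh σ σs
                (T.patch ((T.elem i).vertex l) ((T.elem i).vertex (l + 1)))
            else 0)) := by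
  refine ⟨fun cT k hcT => exists_residual_bounds cT hcT k, ?_⟩
  intro Ω ΓD ΓN κ cT k m hΩ _ hκ hcT
  obtain ⟨C, hC, hres⟩ := exists_residual_bounds cT hcT (m + (k + 1))
  obtain ⟨C', hC', hosc⟩ := hκ.exists_errOscSq_bound hΩ.isBounded
  refine ⟨C ^ 2 * C', by positivity, ?_⟩
  intro f G G' σ σ' u _ hG hsol T hT _ c₀ c₁ S _ _ _ σh σh' uh σs κh _ hpost hκh
  have hζ := hsol.hasWeakRot hΩ.isBounded hκ hG
  have hq : ∀ i, IsPField ((m + (k + 1) : ℕ) : ℤ) ((κh i).mulVec (σs i)) := fun i =>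
    isPField_mulVec (hκh i) (hpost i).1
  obtain ⟨hrot, hjump⟩ := hres Ω T hΩ hT (fun l => (κh l).mulVec (σs l)) _ hq hζ
  have hE := hosc T κh σ σs hsol.memH.hasWeakDiv.isL2
  have hedge : ∀ i j a b, T.IsInteriorEdge i j a b →
      dist a b * edgeNorm a b (tangentialJump (fun l => (κh l).mulVec (σs l)) i j a b) ^ 2 ≤
        C ^ 2 * C' * T.errOscSq κ κh σ σs (T.patch a b) := by
    intro i j a b h
    have h1 := hjump i j a b h
    have h2 := hE (T.patch a b) (T.patch_subset a b) (T.measurableSet_patch a b)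
      fun x hx => Mesh.exists_mem_of_mem_patch hx
    have h3 := pow_le_pow_left₀ (mul_nonneg (Real.sqrt_nonneg _) (Real.sqrt_nonneg _)) h1 2
    rw [mul_pow, mul_pow, Real.sq_sqrt dist_nonneg] at h3
    calc _ ≤ _ := h3
      _ ≤ C ^ 2 * (C' * T.errOscSq κ κh σ σs (T.patch a b)) := by gcongr
      _ = _ := by ring
  refine ⟨fun i => ?_, hedge, fun i => ?_⟩
  · have h2 := hE (T.elem i).carrier (T.subset i) (T.elem i).isOpen.measurableSet
      fun x hx => ⟨i, hx⟩
    have h3 := pow_le_pow_left₀ (mul_nonneg Metric.diam_nonneg l2norm_nonneg) (hrot i) 2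
    rw [mul_pow, mul_pow] at h3
    calc _ ≤ _ := h3
      _ ≤ C ^ 2 * (C' * T.errOscSq κ κh σ σs (T.elem i).carrier) := by gcongr
      _ = _ := by ring
  · rw [Mesh.thetaTwoSq, Finset.mul_sum]
    refine Finset.sum_le_sum fun l _ => ?_
    set a := (T.elem i).vertex l
    set b := (T.elem i).vertex (l + 1)
    have hpos : 0 ≤ T.errOscSq κ κh σ σs (T.patch a b) :=
      add_nonneg (sq_nonneg _) (sq_nonneg _)
    by_cases hex : ∃ j, T.IsInteriorEdge i j a b
    · obtain ⟨j, hj⟩ := hex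
      -- at most one other element has the edge `ab`
      rw [Finset.sum_eq_single j]
      · simp only [if_pos hj, if_pos hj.2.2.2]
        exact hedge i j a b hj
      · intro j' _ hj'
        exact if_neg fun h => hj' (hT.eq_of_isInteriorEdge hcT h hj)
      · simp
    · rw [Finset.sum_eq_zero fun j _ => if_neg fun h => hex ⟨j, h⟩]
      split_ifs
      · positivity
      · simp
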